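/- Let $m$ be a positive integer and let $I$ be the $m\times m$ identity matrix. A pencil $L$ is given by $m\times m$ complex matrix functions $Q_1,Q_0$ on $[0,\pi]$, the entries of $Q_1$ being absolutely continuous and those of $Q_0$ integrable (that is, $Q_s$ has entries in $W_1^s[0,\pi]$, $s=0,1$), and by complex $m\times m$ matrices $h_1,h_0,H_1,H_0$ with $\det(I\pm h_1)\neq 0$ and $\det(I\pm H_1)\ne 0$. It represents the boundary value problem $$Y''+(\rho^2 I+2i\rho Q_1(x)+Q_0(x))Y=0,\quad x\in(0,\pi),$$ $$U(Y):=Y'(0)+(i\rho h_1+h_0)Y(0)=0,\qquad V(Y):=Y'(\pi)+(i\rho H_1+H_0)Y(\pi)=0,$$ where $\rho\in\mathbb C$ is the spectral parameter; a solution $Y$ is differentiable on $[0,\pi]$ with $Y'$ absolutely continuous, and the equation holds almost everywhere. The Weyl solution $\Phi(x,\rho)$ is the $m\times m$ matrix solution of the equation with $U(\Phi)=I$ and $V(\Phi)=0$ (it exists, and is then unique, exactly when $\rho$ is not an eigenvalue of $L$), and the Weyl matrix is $M(\rho):=\Phi(0,\rho)$. Let $L$ and $\tilde L$ be two such pencils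 of the same size $m$, with Weyl matrices $M$ and $\tilde M$. If $M(\rho)=\tilde M(\rho)$ for every $\rho\in\mathbb C$ at which both are defined, then $L=\tilde L$; that is, $Q_1=\tilde Q_1$ on $[0,\pi]$, $Q_0=\tilde Q_0$ almost everywhere on $[0,\pi]$, and $h_1=\tilde h_1$, $h_0=\tilde h_0$, $H_1=\tilde H_1$, $H_0=\tilde H_0$. -/

import Mathlib

open Set MeasureTheory

/-- The boundary value problem `L(ℓ, U, V)`: the coefficients of
`Y'' + (ρ² I + 2 i ρ Q₁(x) + Q₀(x)) Y = 0` on `(0, π)` and of the boundary conditions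
`Y'(0) + (i ρ h₁ + h₀) Y(0) = 0`, `Y'(π) + (i ρ H₁ + H₀) Y(π) = 0`.
The entries of `Q₁` lie in `W_1^1[0, π]` (absolutely continuous functions) and those of `Q₀` lie in
`W_1^0[0, π] = L_1[0, π]`. Only the values of `Q₁`, `Q₀` on `[0, π]` matter. -/
structure QuadraticPencil (m : ℕ) where
  Q1 : ℝ → Matrix (Fin m) (Fin m) ℂ
  Q0 : ℝ → Matrix (Fin m) (Fin m) ℂ
  h1 : Matrix (Fin m) (Fin m) ℂ
  h0 : Matrix (Fin m) (Fin m) ℂ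
  H1 : Matrix (Fin m) (Fin m) ℂ
  H0 : Matrix (Fin m) (Fin m) ℂ
  absolutelyContinuous_Q1 :
    ∀ j k, AbsolutelyContinuousOnInterval (fun x => Q1 x j k) 0 Real.pi
  integrable_Q0 : ∀ j k, IntegrableOn (fun x => Q0 x j k) (Icc 0 Real.pi)

namespace QuadraticPencil

variable {m : ℕ}

/-- The standing assumption `det (I ± h₁) ≠ 0`, `det (I ± H₁) ≠ 0`. -/
structure NonRegge (L : QuadraticPencil m) : Prop where
  det_one_add_h1 : (1 + L.h1).det ≠ 0
  det_one_sub_h1 : (1 - L.h1).det ≠ 0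
  det_one_add_H1 : (1 + L.H1).det ≠ 0
  det_one_sub_H1 : (1 - L.H1).det ≠ 0

/-- `ρ² I + 2 i ρ Q₁(x) + Q₀(x)`. -/
noncomputable def potential (L : QuadraticPencil m) (ρ : ℂ) (x : ℝ) : Matrix (Fin m) (Fin m) ℂ :=
  ρ ^ 2 • (1 : Matrix (Fin m) (Fin m) ℂ) + (2 * Complex.I * ρ) • L.Q1 x + L.Q0 x

/-- `Y` is a matrix solution on `[0, π]` of `Y'' + (ρ² I + 2 i ρ Q₁ + Q₀) Y = 0`, with derivative
`Y'` (one-sided at the end points): `Y'` is absolutely continuous and the equation holds almost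
everywhere. -/
structure IsSolution (L : QuadraticPencil m) (ρ : ℂ)
    (Y Y' : ℝ → Matrix (Fin m) (Fin m) ℂ) : Prop where
  hasDeriv : ∀ x ∈ Icc 0 Real.pi, ∀ j k,
    HasDerivWithinAt (fun t => Y t j k) (Y' x j k) (Icc 0 Real.pi) x
  absolutelyContinuous : ∀ j k, AbsolutelyContinuousOnInterval (fun x => Y' x j k) 0 Real.pi
  equation : ∀ᵐ x ∂(volume.restrict (Icc 0 Real.pi)), ∀ j k,
    HasDerivAt (fun t => Y' t j k) (-(L.potential ρ x * Y x) j k) x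

/-- The boundary form `U(Y) = Y'(0) + (i ρ h₁ + h₀) Y(0)`. -/
noncomputable def U (L : QuadraticPencil m) (ρ : ℂ)
    (Y Y' : ℝ → Matrix (Fin m) (Fin m) ℂ) : Matrix (Fin m) (Fin m) ℂ :=
  Y' 0 + ((Complex.I * ρ) • L.h1 + L.h0) * Y 0

/-- The boundary form `V(Y) = Y'(π) + (i ρ H₁ + H₀) Y(π)`. -/
noncomputable def V (L : QuadraticPencil m) (ρ : ℂ)
    (Y Y' : ℝ → Matrix (Fin m) (Fin m) ℂ) : Matrix (Fin m) (Fin m) ℂ :=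
  Y' Real.pi + ((Complex.I * ρ) • L.H1 + L.H0) * Y Real.pi

/-- `Φ` (with derivative `Φ'`) is the Weyl solution for `L` at `ρ`: it solves the equation and
`U(Φ) = I`, `V(Φ) = 0`. -/
structure IsWeylSolution (L : QuadraticPencil m) (ρ : ℂ)
    (Φ Φ' : ℝ → Matrix (Fin m) (Fin m) ℂ) : Prop where
  isSolution : L.IsSolution ρ Φ Φ'
  U_eq_one : L.U ρ Φ Φ' = 1
  V_eq_zero : L.V ρ Φ Φ' = 0

/-- The set of `ρ` at which the Weyl solution exists (the complement of the set of eigenvalues).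
At such a `ρ` the values of the Weyl solution on `[0, π]` are unique. -/
def weylDomain (L : QuadraticPencil m) : Set ℂ :=
  {ρ | ∃ Φ Φ' : ℝ → Matrix (Fin m) (Fin m) ℂ, L.IsWeylSolution ρ Φ Φ'}

open Classical in
/-- The Weyl matrix `M(ρ) = Φ(0, ρ)`, meaningful for `ρ ∈ L.weylDomain` (and `0` elsewhere). -/
noncomputable def weylMatrix (L : QuadraticPencil m) (ρ : ℂ) : Matrix (Fin m) (Fin m) ℂ :=
  if h : ∃ Φ Φ' : ℝ → Matrix (Fin m) (Fin m) ℂ, L.IsWeylSolution ρ Φ Φ' then h.choose 0 else 0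

end QuadraticPencil

section LinearODE

theorem differentiable_inverse_one_sub {R : Type*} [NormedRing R] [NormedAlgebra ℂ R]
    [CompleteSpace R] {S : ℂ → R} (hS : Differentiable ℂ S) (hu : ∀ ρ, IsUnit (1 - S ρ)) :
    Differentiable ℂ fun ρ => Ring.inverse (1 - S ρ) := fun ρ =>
  DifferentiableAt.comp (g := Ring.inverse) ρ (differentiableAt_inverse (hu ρ)) ((hS ρ).const_sub 1)

variable {F : Type*} [NormedAddCommGroup F] [NormedSpace ℂ F]

theorem differentiable_quadratic {G : Type*} [NormedAddCommGroup G] [NormedSpace ℂ G]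
    (u v w : G) : Differentiable ℂ fun ρ : ℂ => u + ρ • v + ρ ^ 2 • w := by
  fun_prop

/-- The Volterra operator `f ↦ ∫₀ˣ A f` on `C([0, b], F)`. -/
noncomputable def volterra [CompleteSpace F] {b : ℝ} (hb : 0 ≤ b) (A : ℝ → F →L[ℂ] F) (hA : Continuous A) :
    C(Icc (0 : ℝ) b, F) →L[ℂ] C(Icc (0 : ℝ) b, F) :=
  LinearMap.mkContinuousOfExistsBound
    { toFun := fun f =>
        ⟨fun x => ∫ t in (0 : ℝ)..x, A t (IccExtend hb f t),
          (intervalIntegral.continuous_primitive (fun _ _ =>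
            (hA.clm_apply f.continuous.Icc_extend').intervalIntegrable _ _) 0).comp
            continuous_subtype_val⟩
      map_add' := fun f g => by
        ext x
        have h1 := (hA.clm_apply (f.continuous.Icc_extend' (h := hb)))
        have h2 := (hA.clm_apply (g.continuous.Icc_extend' (h := hb)))
        have := intervalIntegral.integral_add (h1.intervalIntegrable 0 x)
          (h2.intervalIntegrable (μ := volume) 0 x)
        simpa only [ContinuousMap.add_apply, IccExtend, Function.comp_apply, map_add] using! this
      map_smul' := fun c f => by
        ext x
        have h : ∀ t, A t (IccExtend hb (c • ⇑f) t) = c • A t (IccExtend hb f t) := fun t => by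
          simp [IccExtend]
        simp [h, intervalIntegral.integral_smul] }
    (by
      obtain ⟨C, hC⟩ := isCompact_Icc.exists_bound_of_continuousOn
        (s := Icc (0 : ℝ) b) hA.continuousOn
      refine ⟨C * b, fun f => ?_⟩
      have hC0 : 0 ≤ C := (norm_nonneg _).trans (hC 0 ⟨le_rfl, hb⟩)
      refine (ContinuousMap.norm_le _ (by positivity)).2 fun x => ?_
      have hx := x.2
      have : ‖∫ t in (0 : ℝ)..x, A t (IccExtend hb f t)‖ ≤ C * ‖f‖ * |(x : ℝ) - 0| := by
        refine intervalIntegral.norm_integral_le_of_norm_le_const fun t ht => ?_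
        rw [uIoc_of_le hx.1] at ht
        refine ((A t).le_opNorm _).trans ?_
        gcongr
        · exact hC t ⟨ht.1.le, ht.2.trans hx.2⟩
        · exact f.norm_coe_le_norm _
      refine this.trans ?_
      rw [sub_zero, abs_of_nonneg hx.1]
      have : C * ‖f‖ * (x : ℝ) ≤ C * ‖f‖ * b := by gcongr; exact hx.2
      linarith)

variable [CompleteSpace F] {b : ℝ}

theorem volterra_apply (hb : 0 ≤ b) (A : ℝ → F →L[ℂ] F) (hA : Continuous A) (f : C(Icc (0 : ℝ) b, F))
    (x : Icc (0 : ℝ) b) :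
    volterra hb A hA f x = ∫ t in (0 : ℝ)..x, A t (IccExtend hb f t) := rfl

theorem norm_volterra_pow_apply_le (hb : 0 ≤ b) (A : ℝ → F →L[ℂ] F) (hA : Continuous A) {C : ℝ}
    (hC : ∀ x ∈ Icc (0 : ℝ) b, ‖A x‖ ≤ C) (f : C(Icc (0 : ℝ) b, F)) (n : ℕ)
    (x : Icc (0 : ℝ) b) :
    ‖(volterra hb A hA ^ n) f x‖ ≤ (C * x) ^ n / n.factorial * ‖f‖ := by
  have hC0 : 0 ≤ C := (norm_nonneg _).trans (hC 0 ⟨le_rfl, hb⟩)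
  induction n generalizing x with
  | zero => simpa using f.norm_coe_le_norm x
  | succ n ih =>
    have hx := x.2
    rw [pow_succ', mul_apply_eq_comp, volterra_apply]
    have hint : ∫ t in (0 : ℝ)..x, C * ((C * t) ^ n / n.factorial * ‖f‖)
        = (C * x) ^ (n + 1) / (n + 1).factorial * ‖f‖ := by
      have : (fun t : ℝ => C * ((C * t) ^ n / n.factorial * ‖f‖))
          = fun t => (C ^ (n + 1) / n.factorial * ‖f‖) * t ^ n := by
        ext t; rw [mul_pow]; ring
      rw [this, intervalIntegral.integral_const_mul, integral_pow, Nat.factorial_succ]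
      push_cast
      rw [mul_pow]
      field_simp
      simp
    rw [← hint]
    refine intervalIntegral.norm_integral_le_of_norm_le hx.1 ?_ ?_
    · refine Filter.Eventually.of_forall fun t ht => ?_
      have htb : t ∈ Icc (0 : ℝ) b := ⟨ht.1.le, ht.2.trans hx.2⟩
      refine ((A t).le_opNorm _).trans ?_
      rw [IccExtend_of_mem hb _ htb]
      gcongr
      · exact hC t htb
      · exact ih ⟨t, htb⟩
    · exact Continuous.intervalIntegrable (by fun_prop) _ _

theorem isUnit_one_sub_volterra (hb : 0 ≤ b) (A : ℝ → F →L[ℂ] F) (hA : Continuous A) :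
    IsUnit (1 - volterra hb A hA) := by
  obtain ⟨C, hC⟩ := isCompact_Icc.exists_bound_of_continuousOn
    (s := Icc (0 : ℝ) b) hA.continuousOn
  have hC0 : 0 ≤ C := (norm_nonneg _).trans (hC 0 ⟨le_rfl, hb⟩)
  obtain ⟨n, hn⟩ : ∃ n : ℕ, (C * b) ^ n / n.factorial < 1 :=
    ((FloorSemiring.tendsto_pow_div_factorial_atTop (C * b)).eventually_lt_const
      one_pos).exists
  have hnorm : ‖volterra hb A hA ^ n‖ < 1 := by
    refine lt_of_le_of_lt (ContinuousLinearMap.opNorm_le_bound _ (by positivity) fun f => ?_) hn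
    refine (ContinuousMap.norm_le _ (by positivity)).2 fun x => ?_
    refine (norm_volterra_pow_apply_le hb A hA hC f n x).trans ?_
    have := x.2.1
    gcongr
    exact x.2.2
  have h1 : IsUnit (1 - volterra hb A hA ^ n) := isUnit_one_sub_of_norm_lt_one (x := volterra hb A hA ^ n) hnorm
  rw [← mul_neg_geom_sum] at h1
  refine ((Commute.isUnit_mul_iff ?_).1 h1).1
  exact (Commute.sum_right _ _ _ fun i _ =>
    ((Commute.one_left _).sub_left ((Commute.refl _).pow_right i)))

theorem exists_entire_solution_linear_ode (hb : 0 ≤ b) {A₀ A₁ A₂ : ℝ → F →L[ℂ] F} (h₀ : Continuous A₀)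
    (h₁ : Continuous A₁) (h₂ : Continuous A₂) (w₀ : F) :
    ∃ w : ℂ → ℝ → F, (∀ ρ, w ρ 0 = w₀) ∧
      (∀ ρ, ∀ x ∈ Icc 0 b,
        HasDerivAt (w ρ) ((A₀ x + ρ • A₁ x + ρ ^ 2 • A₂ x) (w ρ x)) x) ∧
      ∀ x ∈ Icc 0 b, Differentiable ℂ fun ρ => w ρ x := by
  have hA : ∀ ρ : ℂ, Continuous fun x => A₀ x + ρ • A₁ x + ρ ^ 2 • A₂ x := fun ρ => by fun_prop
  set S : ℂ → C(Icc (0 : ℝ) b, F) →L[ℂ] C(Icc (0 : ℝ) b, F) := fun ρ => volterra hb _ (hA ρ)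
    with hS
  have hSeq : S = fun ρ => volterra hb A₀ h₀ + ρ • volterra hb A₁ h₁
      + ρ ^ 2 • volterra hb A₂ h₂ := by
    ext ρ f x
    have i0 := (h₀.clm_apply (f.continuous.Icc_extend' (h := hb))).intervalIntegrable
      (μ := volume) 0 x
    have i1 : IntervalIntegrable (fun t => ρ • A₁ t (IccExtend hb f t)) volume 0 x :=
      ((h₁.clm_apply (f.continuous.Icc_extend' (h := hb))).const_smul ρ).intervalIntegrable _ _
    have i2 : IntervalIntegrable (fun t => ρ ^ 2 • A₂ t (IccExtend hb f t)) volume 0 x :=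
      ((h₂.clm_apply (f.continuous.Icc_extend' (h := hb))).const_smul (ρ ^ 2)).intervalIntegrable _ _
    simp only [hS, volterra_apply, add_apply, smul_apply,
      ContinuousMap.add_apply, ContinuousMap.smul_apply]
    rw [intervalIntegral.integral_add (i0.add i1) i2, intervalIntegral.integral_add i0 i1,
      intervalIntegral.integral_smul, intervalIntegral.integral_smul]
  have hSd : Differentiable ℂ S := by
    rw [hSeq]
    exact differentiable_quadratic (G := C(Icc (0 : ℝ) b, F) →L[ℂ] C(Icc (0 : ℝ) b, F)) _ _ _
  have hu : ∀ ρ, IsUnit (1 - S ρ) := fun ρ => isUnit_one_sub_volterra hb _ (hA ρ)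
  set f : ℂ → C(Icc (0 : ℝ) b, F) := fun ρ => Ring.inverse (1 - S ρ) (ContinuousMap.const _ w₀)
    with hf
  have hfeq : ∀ ρ, f ρ = ContinuousMap.const _ w₀ + S ρ (f ρ) := fun ρ => by
    have h := congrArg (fun T => T (ContinuousMap.const (Icc (0 : ℝ) b) w₀))
      (Ring.mul_inverse_cancel _ (hu ρ))
    simp only [mul_apply_eq_comp, sub_apply,
      one_apply_eq_self] at h
    rw [← h]
    simp [hf]
  have hfd : Differentiable ℂ f := fun ρ => by
    have h2 := (differentiable_inverse_one_sub (S := S) hSd hu) ρ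
    exact h2.clm_apply (differentiableAt_const _)
  set w : ℂ → ℝ → F := fun ρ x =>
    w₀ + ∫ t in (0 : ℝ)..x, (A₀ t + ρ • A₁ t + ρ ^ 2 • A₂ t) (IccExtend hb (f ρ) t) with hw
  have hwf : ∀ ρ, ∀ x (hx : x ∈ Icc 0 b), w ρ x = f ρ ⟨x, hx⟩ := fun ρ x hx => by
    conv_rhs => rw [hfeq ρ]
    rfl
  refine ⟨w, fun ρ => by simp [hw], fun ρ x hx => ?_, fun x hx => ?_⟩
  · have hc := (hA ρ).clm_apply ((f ρ).continuous.Icc_extend' (h := hb))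
    have := (intervalIntegral.integral_hasDerivAt_right (hc.intervalIntegrable (μ := volume) 0 x)
      (hc.stronglyMeasurableAtFilter _ _) hc.continuousAt).const_add w₀
    rw [hwf ρ x hx]
    convert this using 2
    exact (IccExtend_of_mem hb _ hx).symm
  · have : (fun ρ => w ρ x) = fun ρ => ContinuousMap.evalCLM ℂ (⟨x, hx⟩ : Icc (0 : ℝ) b) (f ρ) := by
      ext ρ; rw [hwf ρ x hx]; rfl
    rw [this]
    exact (ContinuousLinearMap.differentiable _).comp hfd

end LinearODE

section Dichotomy

variable {E : Type*} [NormedAddCommGroup E] [InnerProductSpace ℂ E]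

theorem le_of_hasDerivAt_nonpos {h h' : ℝ → ℝ} {a b : ℝ}
    (hd : ∀ x ∈ Icc a b, HasDerivAt h (h' x) x) (hn : ∀ x ∈ Icc a b, h' x ≤ 0) :
    AntitoneOn h (Icc a b) :=
  antitoneOn_of_deriv_nonpos (convex_Icc a b)
    (fun x hx => (hd x hx).continuousAt.continuousWithinAt)
    (fun x hx => (hd x (interior_subset hx)).differentiableAt.differentiableWithinAt)
    (fun x hx => by rw [(hd x (interior_subset hx)).deriv]; exact hn x (interior_subset hx))

theorem exists_hasDerivAt_norm_sq {w : ℝ → E} {c : ℂ} {r : E} {x : ℝ}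
    (hw : HasDerivAt w (c • w x + r) x) :
    ∃ d, HasDerivAt (fun t => ‖w t‖ ^ 2) d x ∧ |d - 2 * c.re * ‖w x‖ ^ 2| ≤ 2 * ‖w x‖ * ‖r‖ := by
  let _ : InnerProductSpace ℝ E := InnerProductSpace.complexToReal
  refine ⟨_, HasDerivAt.norm_sq hw, ?_⟩
  have h1 : inner ℝ (w x) (c • w x) = c.re * ‖w x‖ ^ 2 := by
    rw [real_inner_eq_re_inner ℂ, inner_smul_right, inner_self_eq_norm_sq_to_K]
    change (c * ((‖w x‖ : ℝ) : ℂ) ^ 2).re = _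
    rw [← Complex.ofReal_pow, Complex.re_mul_ofReal]
  rw [inner_add_right, h1]
  have := abs_real_inner_le_norm (w x) r
  rw [show 2 * (c.re * ‖w x‖ ^ 2 + inner ℝ (w x) r) - 2 * c.re * ‖w x‖ ^ 2
    = 2 * inner ℝ (w x) r by ring, abs_mul, abs_two]
  linarith

/-- A system `u' = iρu + f`, `v' = -iρv + g` on `[0, b]` with remainders bounded by `u` and `v`. -/
structure IsDichotomous (ρ : ℂ) (K b : ℝ) (u v f g : ℝ → E) : Prop where
  deriv_u : ∀ x ∈ Icc 0 b, HasDerivAt u ((Complex.I * ρ) • u x + f x) x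
  deriv_v : ∀ x ∈ Icc 0 b, HasDerivAt v ((-(Complex.I * ρ)) • v x + g x) x
  norm_f : ∀ x ∈ Icc 0 b, ‖f x‖ ≤ K * (‖u x‖ + ‖v x‖)
  norm_g : ∀ x ∈ Icc 0 b, ‖g x‖ ≤ K * (‖u x‖ + ‖v x‖)

namespace IsDichotomous

variable {ρ : ℂ} {K b : ℝ} {u v f g : ℝ → E}

theorem reflect (h : IsDichotomous ρ K b u v f g) :
    IsDichotomous ρ K b (fun x => v (b - x)) (fun x => u (b - x)) (fun x => -g (b - x))
      (fun x => -f (b - x)) where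
  deriv_u x hx := by
    convert (h.deriv_v (b - x) ⟨by linarith [hx.2], by linarith [hx.1]⟩).comp_const_sub b x using 1
    module
  deriv_v x hx := by
    convert (h.deriv_u (b - x) ⟨by linarith [hx.2], by linarith [hx.1]⟩).comp_const_sub b x using 1
    module
  norm_f x hx := by
    rw [norm_neg, add_comm]
    exact h.norm_g _ ⟨by linarith [hx.2], by linarith [hx.1]⟩
  norm_g x hx := by
    rw [norm_neg, add_comm]
    exact h.norm_f _ ⟨by linarith [hx.2], by linarith [hx.1]⟩

theorem exists_deriv_sq (h : IsDichotomous ρ K b u v f g) (hK : 0 ≤ K) {x : ℝ}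
    (hx : x ∈ Icc 0 b) :
    ∃ d e, HasDerivAt (fun t => ‖u t‖ ^ 2) d x ∧ HasDerivAt (fun t => ‖v t‖ ^ 2) e x ∧
      |d + 2 * ρ.im * ‖u x‖ ^ 2| ≤ K * (3 * ‖u x‖ ^ 2 + ‖v x‖ ^ 2) ∧
      |e - 2 * ρ.im * ‖v x‖ ^ 2| ≤ K * (‖u x‖ ^ 2 + 3 * ‖v x‖ ^ 2) := by
  obtain ⟨d, hd, hd'⟩ := exists_hasDerivAt_norm_sq (h.deriv_u x hx)
  obtain ⟨e, he, he'⟩ := exists_hasDerivAt_norm_sq (h.deriv_v x hx)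
  refine ⟨d, e, hd, he, ?_, ?_⟩
  · have h1 : 2 * ‖u x‖ * ‖f x‖ ≤ 2 * ‖u x‖ * (K * (‖u x‖ + ‖v x‖)) := by
      gcongr; exact h.norm_f x hx
    have h2 : 0 ≤ K * (‖u x‖ - ‖v x‖) ^ 2 := by positivity
    simp only [Complex.mul_re, Complex.I_re, Complex.I_im] at hd'
    rw [show d + 2 * ρ.im * ‖u x‖ ^ 2 = d - 2 * (0 * ρ.re - 1 * ρ.im) * ‖u x‖ ^ 2 by ring]
    linarith
  · have h1 : 2 * ‖v x‖ * ‖g x‖ ≤ 2 * ‖v x‖ * (K * (‖u x‖ + ‖v x‖)) := by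
      gcongr; exact h.norm_g x hx
    have h2 : 0 ≤ K * (‖u x‖ - ‖v x‖) ^ 2 := by positivity
    simp only [Complex.neg_re, Complex.mul_re, Complex.I_re, Complex.I_im] at he'
    rw [show e - 2 * ρ.im * ‖v x‖ ^ 2 = e - 2 * -(0 * ρ.re - 1 * ρ.im) * ‖v x‖ ^ 2 by ring]
    linarith

/-- A cone condition at `0` improves exponentially fast. -/
theorem cone (h : IsDichotomous ρ K b u v f g) (hK : 0 ≤ K) {p q : ℝ} (hp : 0 ≤ p) (hq : 0 < q)
    (h0 : ‖u 0‖ ^ 2 ≤ p * ‖v 0‖ ^ 2) (h₁ : 3 * K + K * (p + q) ≤ 2 * ρ.im)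
    (h₂ : K + 3 * K * q ≤ ρ.im * q) {x : ℝ} (hx : x ∈ Icc 0 b) :
    ‖u x‖ ^ 2 ≤ (p * Real.exp (-(ρ.im * x)) + q) * ‖v x‖ ^ 2 := by
  set τ := ρ.im with hτ
  choose! d e hd he hd' he' using fun x (hx : x ∈ Icc 0 b) => h.exists_deriv_sq hK hx
  set k : ℝ → ℝ := fun x => p * Real.exp (-(τ * x)) + q with hk
  have hkd : ∀ x, HasDerivAt k (-τ * (k x - q)) x := fun x => by
    have h1 : HasDerivAt (fun x : ℝ => -(τ * x)) (-τ) x := by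
      simpa using (hasDerivAt_id' x).const_mul (-τ)
    refine ((h1.exp.const_mul p).add_const q).congr_deriv ?_
    simp only [hk]; ring
  have hanti := le_of_hasDerivAt_nonpos (h := fun x => ‖u x‖ ^ 2 - k x * ‖v x‖ ^ 2)
    (fun x hx => (hd x hx).sub ((hkd x).mul (he x hx))) (fun x hx => by
      have h3τ : 3 * K ≤ τ := by
        have : 3 * K * q ≤ τ * q := by linarith
        exact le_of_mul_le_mul_right this hq
      have hτ0 : 0 ≤ τ := by linarith
      have hkq : q ≤ k x := by simp only [hk]; linarith [mul_nonneg hp (Real.exp_pos (-(τ * x))).le]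
      have hkp : k x ≤ p + q := by
        have : Real.exp (-(τ * x)) ≤ 1 := Real.exp_le_one_iff.2 (by nlinarith [hx.1])
        simp only [hk]; nlinarith
      have hk0 : 0 ≤ k x := hq.le.trans hkq
      have e1 := (abs_le.1 (hd' x hx)).2
      have e2 := (abs_le.1 (he' x hx)).1
      have e3 := mul_le_mul_of_nonneg_left e2 hk0
      have e4 : K * k x ≤ K * (p + q) := mul_le_mul_of_nonneg_left hkp hK
      have e5 : 0 ≤ (2 * τ - 3 * K - K * k x) * ‖u x‖ ^ 2 :=
        mul_nonneg (by linarith) (sq_nonneg _)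
      have e6 : 0 ≤ ((τ - 3 * K) * k x - K) := by
        nlinarith [mul_le_mul_of_nonneg_left hkq (sub_nonneg.2 h3τ)]
      have e7 : 0 ≤ ((τ - 3 * K) * k x - K + τ * q) * ‖v x‖ ^ 2 :=
        mul_nonneg (by linarith [mul_nonneg hτ0 hq.le]) (sq_nonneg _)
      nlinarith)
  have h00 : ‖u 0‖ ^ 2 - k 0 * ‖v 0‖ ^ 2 ≤ 0 := by
    have : 0 ≤ q * ‖v 0‖ ^ 2 := by positivity
    simp only [hk, mul_zero, neg_zero, Real.exp_zero, mul_one]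
    linarith
  have := hanti ⟨le_rfl, hx.1.trans hx.2⟩ hx hx.1
  simp only at this
  linarith

theorem growth (h : IsDichotomous ρ K b u v f g) (hK : 0 ≤ K) {r : ℝ}
    (hr : ∀ x ∈ Icc 0 b, ‖u x‖ ^ 2 ≤ r * ‖v x‖ ^ 2) {x : ℝ} (hx : x ∈ Icc 0 b) :
    Real.exp ((2 * ρ.im - K * (3 + r)) * x) * ‖v 0‖ ^ 2 ≤ ‖v x‖ ^ 2 ∧
      ‖v x‖ ^ 2 ≤ Real.exp ((2 * ρ.im + K * (3 + r)) * x) * ‖v 0‖ ^ 2 := by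
  choose! d e hd he hd' he' using fun x (hx : x ∈ Icc 0 b) => h.exists_deriv_sq hK hx
  have hexp : ∀ c x : ℝ, HasDerivAt (fun x => Real.exp (-(c * x))) (-c * Real.exp (-(c * x))) x :=
    fun c x => by
      have h1 : HasDerivAt (fun x : ℝ => -(c * x)) (-c) x := by
        simpa using (hasDerivAt_id' x).const_mul (-c)
      exact h1.exp.congr_deriv (mul_comm _ _)
  have hbd : ∀ x ∈ Icc 0 b, |e x - 2 * ρ.im * ‖v x‖ ^ 2| ≤ K * (3 + r) * ‖v x‖ ^ 2 := fun x hx =>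
    (he' x hx).trans (by nlinarith [mul_le_mul_of_nonneg_left (hr x hx) hK])
  have h0m : (0 : ℝ) ∈ Icc 0 b := ⟨le_rfl, hx.1.trans hx.2⟩
  have key : ∀ c : ℝ, Real.exp (c * x) * Real.exp (-(c * x)) = 1 := fun c => by
    rw [← Real.exp_add]; simp
  constructor
  · set c := 2 * ρ.im - K * (3 + r) with hc
    have := le_of_hasDerivAt_nonpos (h := fun x => -(Real.exp (-(c * x)) * ‖v x‖ ^ 2))
      (fun x hx => ((hexp c x).mul (he x hx)).neg) (fun x hx => by
        have := (abs_le.1 (hbd x hx)).1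
        have h2 := mul_nonneg (Real.exp_pos (-(c * x))).le
          (show 0 ≤ e x - c * ‖v x‖ ^ 2 by rw [hc]; linarith)
        linarith) h0m hx hx.1
    simp only [mul_zero, neg_zero, Real.exp_zero, one_mul] at this
    have h3 := mul_le_mul_of_nonneg_left this (Real.exp_pos (c * x)).le
    rw [mul_neg, mul_neg, ← mul_assoc, key, one_mul] at h3
    linarith
  · set c := 2 * ρ.im + K * (3 + r) with hc
    have := le_of_hasDerivAt_nonpos (h := fun x => Real.exp (-(c * x)) * ‖v x‖ ^ 2)
      (fun x hx => (hexp c x).mul (he x hx)) (fun x hx => by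
        have := (abs_le.1 (hbd x hx)).2
        have h2 := mul_nonneg (Real.exp_pos (-(c * x))).le
          (show 0 ≤ c * ‖v x‖ ^ 2 - e x by rw [hc]; linarith)
        linarith) h0m hx hx.1
    simp only [mul_zero, neg_zero, Real.exp_zero, one_mul] at this
    have h3 := mul_le_mul_of_nonneg_left this (Real.exp_pos (c * x)).le
    rw [← mul_assoc, key, one_mul] at h3
    linarith

end IsDichotomous

/-- Solutions in a cone at `0`: for `Im ρ` large they grow like `exp (x Im ρ)`. -/
theorem exists_growing_bounds {K b κ δ x₀ : ℝ} (hK : 0 ≤ K) (hδ : 0 < δ)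
    (hx₀ : x₀ ∈ Ioc 0 b) :
    ∃ C > 0, ∃ R, ∀ ρ : ℂ, R ≤ ρ.im → ∀ u v f g : ℝ → E, IsDichotomous ρ K b u v f g →
      ‖u 0‖ ≤ κ * ‖v 0‖ → (∀ x ∈ Icc x₀ b, ‖u x‖ ≤ δ * ‖v x‖) ∧
      ∀ x ∈ Icc 0 b, ‖v x‖ ≤ C * Real.exp (ρ.im * x) * ‖v 0‖ ∧
        ‖v 0‖ ≤ C * Real.exp (-(ρ.im * x)) * ‖v x‖ := by
  set q := δ ^ 2 / 2 with hq
  set p := κ ^ 2 with hp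
  have hq0 : 0 < q := by positivity
  have hp0 : 0 ≤ p := by positivity
  have hlim : Filter.Tendsto (fun τ : ℝ => p * Real.exp (-(τ * x₀))) Filter.atTop (nhds 0) := by
    have : Filter.Tendsto (fun τ : ℝ => Real.exp (-(τ * x₀))) Filter.atTop (nhds 0) :=
      Real.tendsto_exp_neg_atTop_nhds_zero.comp (Filter.tendsto_id.atTop_mul_const hx₀.1)
    simpa using this.const_mul p
  obtain ⟨R₀, hR₀⟩ := Filter.eventually_atTop.1 (hlim.eventually_le_const hq0)
  set c := K * (3 + (p + q)) with hc
  refine ⟨Real.exp (c / 2 * b), Real.exp_pos _,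
    max R₀ (max (3 * K + K * (p + q)) (K / q + 3 * K)), fun ρ hρ u v f g h h0 => ?_⟩
  have hτ1 : R₀ ≤ ρ.im := (le_max_left _ _).trans hρ
  have hτ2 : 3 * K + K * (p + q) ≤ ρ.im := ((le_max_left _ _).trans (le_max_right _ _)).trans hρ
  have hτ3 : K / q + 3 * K ≤ ρ.im := ((le_max_right _ _).trans (le_max_right _ _)).trans hρ
  have hτ0 : 0 ≤ ρ.im := le_trans (by positivity) hτ2
  have h0' : ‖u 0‖ ^ 2 ≤ p * ‖v 0‖ ^ 2 := by
    rw [hp, ← mul_pow]; gcongr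
  have hcone : ∀ x ∈ Icc 0 b, ‖u x‖ ^ 2 ≤ (p * Real.exp (-(ρ.im * x)) + q) * ‖v x‖ ^ 2 :=
    fun x hx => h.cone hK hp0 hq0 h0' (by linarith) (by
      have := mul_le_mul_of_nonneg_right hτ3 hq0.le
      rw [add_mul, div_mul_cancel₀ _ hq0.ne'] at this
      exact this) hx
  have hcone' : ∀ x ∈ Icc 0 b, ‖u x‖ ^ 2 ≤ (p + q) * ‖v x‖ ^ 2 := fun x hx => by
    refine (hcone x hx).trans ?_
    have : Real.exp (-(ρ.im * x)) ≤ 1 := Real.exp_le_one_iff.2 (by nlinarith [hx.1])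
    gcongr
    nlinarith
  refine ⟨fun x hx => ?_, fun x hx => ?_⟩
  · have hx' : x ∈ Icc 0 b := ⟨hx₀.1.le.trans hx.1, hx.2⟩
    have h1 : Real.exp (-(ρ.im * x)) ≤ Real.exp (-(ρ.im * x₀)) := by
      gcongr; exact hx.1
    have h2 : p * Real.exp (-(ρ.im * x)) ≤ q :=
      (mul_le_mul_of_nonneg_left h1 hp0).trans (hR₀ _ hτ1)
    have h3 : ‖u x‖ ^ 2 ≤ (δ * ‖v x‖) ^ 2 := by
      refine (hcone x hx').trans ?_
      rw [mul_pow]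
      gcongr
      rw [hq] at h2 ⊢
      linarith
    exact le_of_sq_le_sq h3 (by positivity)
  · obtain ⟨g1, g2⟩ := h.growth hK hcone' hx
    have hcx : c / 2 * x ≤ c / 2 * b := by
      have : 0 ≤ c := by positivity
      gcongr; exact hx.2
    constructor
    · refine (le_of_sq_le_sq (b := Real.exp ((ρ.im + c / 2) * x) * ‖v 0‖) ?_ (by positivity)).trans ?_
      · rw [mul_pow, ← Real.exp_nat_mul]
        refine g2.trans_eq ?_
        rw [hc]; push_cast; ring_nf
      · rw [← Real.exp_add]
        gcongr
        linarith
    · refine (le_of_sq_le_sq (b := Real.exp (-((ρ.im - c / 2) * x)) * ‖v x‖) ?_ (by positivity)).trans ?_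
      · rw [mul_pow, ← Real.exp_nat_mul]
        have := mul_le_mul_of_nonneg_left g1 (Real.exp_pos (-((2 * ρ.im - c) * x))).le
        rw [← mul_assoc, ← Real.exp_add, neg_add_cancel, Real.exp_zero, one_mul] at this
        refine this.trans_eq ?_
        push_cast; ring_nf
      · rw [← Real.exp_add]
        gcongr
        linarith

/-- Solutions in a cone at `b`: for `Im ρ` large they decay like `exp (-x Im ρ)`. -/
theorem exists_decaying_bounds {K b κ δ x₀ : ℝ} (hK : 0 ≤ K) (hδ : 0 < δ)
    (hx₀ : x₀ ∈ Ico 0 b) :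
    ∃ C > 0, ∃ R, ∀ ρ : ℂ, R ≤ ρ.im → ∀ u v f g : ℝ → E, IsDichotomous ρ K b u v f g →
      ‖v b‖ ≤ κ * ‖u b‖ → (∀ x ∈ Icc 0 x₀, ‖v x‖ ≤ δ * ‖u x‖) ∧
      ∀ x ∈ Icc 0 b, ‖u x‖ ≤ C * Real.exp (-(ρ.im * x)) * ‖u 0‖ ∧
        ‖u 0‖ ≤ C * Real.exp (ρ.im * x) * ‖u x‖ := by
  obtain ⟨C, hC, R, hR⟩ := exists_growing_bounds (E := E) (κ := κ) hK hδ
    (show b - x₀ ∈ Ioc 0 b from ⟨by linarith [hx₀.2], by linarith [hx₀.1]⟩)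
  refine ⟨C * C, by positivity, R, fun ρ hρ u v f g h h0 => ?_⟩
  obtain ⟨h1, h2⟩ := hR ρ hρ _ _ _ _ h.reflect (by simpa using h0)
  refine ⟨fun x hx => ?_, fun x hx => ?_⟩
  · simpa using h1 (b - x) ⟨by linarith [hx.2], by linarith [hx.1]⟩
  · obtain ⟨a1, a2⟩ := h2 (b - x) ⟨by linarith [hx.2], by linarith [hx.1]⟩
    obtain ⟨b1, b2⟩ := h2 b ⟨hx.1.trans hx.2, le_rfl⟩
    simp only [sub_sub_cancel, sub_zero, sub_self] at a1 a2 b1 b2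
    constructor
    · refine a1.trans ((mul_le_mul_of_nonneg_left b2 (by positivity)).trans (le_of_eq ?_))
      rw [show -(ρ.im * x) = ρ.im * (b - x) + -(ρ.im * b) by ring, Real.exp_add]
      ring
    · refine b1.trans ((mul_le_mul_of_nonneg_left a2 (by positivity)).trans (le_of_eq ?_))
      rw [show ρ.im * x = ρ.im * b + -(ρ.im * (b - x)) by ring, Real.exp_add]
      ring

end Dichotomy

section SystemPencil

/-- Coefficients of the first-order form `y' = -s y + z`,
`z' = -(ρ² + 2iρ q + s²) y + s z` of a quadratic pencil, with boundary forms
`z + (iρ h₁ + h₀) y` and `z + (iρ H₁ + H₀) y`. -/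
structure SystemPencil (E : Type*) [NormedAddCommGroup E] [InnerProductSpace ℂ E] where
  q : ℝ → E →L[ℂ] E
  s : ℝ → E →L[ℂ] E
  h1 : E →L[ℂ] E
  h0 : E →L[ℂ] E
  H1 : E →L[ℂ] E
  H0 : E →L[ℂ] E
  continuous_q : Continuous q
  continuous_s : Continuous s

variable {E : Type*} [NormedAddCommGroup E] [InnerProductSpace ℂ E]

theorem exists_pos_mul_norm_le_of_isUnit {T : E →L[ℂ] E} (hT : IsUnit T) :
    ∃ μ > 0, ∀ e, μ * ‖e‖ ≤ ‖T e‖ := by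
  obtain ⟨u, rfl⟩ := hT
  set S : E →L[ℂ] E := ((u⁻¹ : (E →L[ℂ] E)ˣ) : E →L[ℂ] E) with hS
  have h : ∀ e, S ((u : E →L[ℂ] E) e) = e := fun e => by
    exact congrArg (fun T : E →L[ℂ] E => T e) u.inv_mul
  refine ⟨(‖S‖ + 1)⁻¹, by positivity, fun e => ?_⟩
  rw [inv_mul_le_iff₀ (by positivity)]
  calc ‖e‖ = ‖S ((u : E →L[ℂ] E) e)‖ := by rw [h]
    _ ≤ ‖S‖ * ‖(u : E →L[ℂ] E) e‖ := S.le_opNorm _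
    _ ≤ _ := by gcongr; linarith

/-- The block operator with entries `A B C D`. -/
noncomputable def blockCLM (A B C D : E →L[ℂ] E) : (E × E) →L[ℂ] (E × E) :=
  (A ∘L ContinuousLinearMap.fst ℂ E E + B ∘L ContinuousLinearMap.snd ℂ E E).prod
    (C ∘L ContinuousLinearMap.fst ℂ E E + D ∘L ContinuousLinearMap.snd ℂ E E)

@[simp]
theorem blockCLM_apply (A B C D : E →L[ℂ] E) (w : E × E) :
    blockCLM A B C D w = (A w.1 + B w.2, C w.1 + D w.2) := rfl

/-- The component of `w` that decays like `exp (iρx)` in the upper half-plane. -/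
noncomputable def decayPart (ρ : ℂ) (w : E × E) : E :=
  (1 / 2 : ℂ) • (w.1 + (Complex.I * ρ)⁻¹ • w.2)

/-- The component of `w` that grows like `exp (-iρx)` in the upper half-plane. -/
noncomputable def growthPart (ρ : ℂ) (w : E × E) : E :=
  (1 / 2 : ℂ) • (w.1 - (Complex.I * ρ)⁻¹ • w.2)

theorem decayPart_add_growthPart (ρ : ℂ) (w : E × E) :
    decayPart ρ w + growthPart ρ w = w.1 := by
  simp only [decayPart, growthPart]
  module

theorem smul_decayPart_sub_growthPart {ρ : ℂ} (hρ : ρ ≠ 0) (w : E × E) :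
    (Complex.I * ρ) • (decayPart ρ w - growthPart ρ w) = w.2 := by
  have : decayPart ρ w - growthPart ρ w = (Complex.I * ρ)⁻¹ • w.2 := by
    simp only [decayPart, growthPart]
    module
  rw [this, smul_smul, mul_inv_cancel₀ (mul_ne_zero Complex.I_ne_zero hρ), one_smul]

theorem decayPart_eq_growthPart_neg (ρ : ℂ) (w : E × E) :
    decayPart ρ w = growthPart (-ρ) w := by
  simp only [decayPart, growthPart, mul_neg, inv_neg, neg_smul, sub_neg_eq_add]

theorem decayPart_add (ρ : ℂ) (w w' : E × E) :
    decayPart ρ (w + w') = decayPart ρ w + decayPart ρ w' := by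
  simp only [decayPart, Prod.fst_add, Prod.snd_add]
  module

theorem growthPart_add (ρ : ℂ) (w w' : E × E) :
    growthPart ρ (w + w') = growthPart ρ w + growthPart ρ w' := by
  simp only [growthPart, Prod.fst_add, Prod.snd_add]
  module

theorem hasDerivAt_prod_fst {w : ℝ → E × E} {w' : E × E} {x : ℝ} (hw : HasDerivAt w w' x) :
    HasDerivAt (fun t => (w t).1) w'.1 x :=
  (hasFDerivAt_fst (𝕜 := ℝ) (E := E) (F := E) (p := w x)).comp_hasDerivAt x hw

theorem hasDerivAt_prod_snd {w : ℝ → E × E} {w' : E × E} {x : ℝ} (hw : HasDerivAt w w' x) :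
    HasDerivAt (fun t => (w t).2) w'.2 x :=
  (hasFDerivAt_snd (𝕜 := ℝ) (E := E) (F := E) (p := w x)).comp_hasDerivAt x hw

theorem hasDerivAt_decayPart (ρ : ℂ) {w : ℝ → E × E} {w' : E × E} {x : ℝ}
    (hw : HasDerivAt w w' x) : HasDerivAt (fun t => decayPart ρ (w t)) (decayPart ρ w') x :=
  ((hasDerivAt_prod_fst hw).add
    ((hasDerivAt_prod_snd hw).const_smul (Complex.I * ρ)⁻¹)).const_smul (1 / 2 : ℂ)

theorem hasDerivAt_growthPart (ρ : ℂ) {w : ℝ → E × E} {w' : E × E} {x : ℝ}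
    (hw : HasDerivAt w w' x) : HasDerivAt (fun t => growthPart ρ (w t)) (growthPart ρ w') x :=
  ((hasDerivAt_prod_fst hw).sub
    ((hasDerivAt_prod_snd hw).const_smul (Complex.I * ρ)⁻¹)).const_smul (1 / 2 : ℂ)

theorem norm_I_mul_inv (ρ : ℂ) : ‖(Complex.I * ρ)⁻¹‖ = ‖ρ‖⁻¹ := by simp

/-- On the graph of a boundary condition whose leading coefficient is invertible, the growing part
controls everything. -/
theorem exists_growthPart_bounds {B₁ B₀ : E →L[ℂ] E} (hB : IsUnit (1 + B₁)) :
    ∃ κ ≥ 0, ∃ ν > 0, ∃ N > 0, ∃ R, ∀ ρ : ℂ, R ≤ ‖ρ‖ → ∀ w : E × E,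
      w.2 + ((Complex.I * ρ) • B₁ + B₀) w.1 = 0 →
      ‖decayPart ρ w‖ ≤ κ * ‖growthPart ρ w‖ ∧ ν * ‖w.1‖ ≤ ‖growthPart ρ w‖ ∧
        ‖growthPart ρ w‖ ≤ N * ‖w.1‖ := by
  obtain ⟨μ, hμ, hμB⟩ := exists_pos_mul_norm_le_of_isUnit hB
  set N := 1 + ‖B₁‖ + ‖B₀‖ with hN
  refine ⟨N / (μ / 4), by positivity, μ / 4, by positivity, N, by positivity,
    max 1 (2 * ‖B₀‖ / μ), fun ρ hρ w hw => ?_⟩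
  have hρ1 : 1 ≤ ‖ρ‖ := (le_max_left _ _).trans hρ
  have hρ2 : 2 * ‖B₀‖ / μ ≤ ‖ρ‖ := (le_max_right _ _).trans hρ
  have hρ0 : ρ ≠ 0 := norm_pos_iff.1 (by linarith)
  have hIρ : Complex.I * ρ ≠ 0 := mul_ne_zero Complex.I_ne_zero hρ0
  have hw2 : (Complex.I * ρ)⁻¹ • w.2 = -(B₁ w.1 + (Complex.I * ρ)⁻¹ • B₀ w.1) := by
    rw [eq_neg_of_add_eq_zero_left hw]
    simp only [add_apply, smul_apply, smul_neg, smul_add]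
    rw [smul_smul, inv_mul_cancel₀ hIρ, one_smul]
  have hg : growthPart ρ w = (1 / 2 : ℂ) • ((1 + B₁) w.1 + (Complex.I * ρ)⁻¹ • B₀ w.1) := by
    simp only [growthPart, hw2, add_apply, one_apply_eq_self]
    module
  have hd : decayPart ρ w = (1 / 2 : ℂ) • (w.1 - B₁ w.1 - (Complex.I * ρ)⁻¹ • B₀ w.1) := by
    simp only [decayPart, hw2]
    module
  have hsmall : ‖(Complex.I * ρ)⁻¹ • B₀ w.1‖ ≤ ‖ρ‖⁻¹ * (‖B₀‖ * ‖w.1‖) := by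
    rw [norm_smul, norm_I_mul_inv]
    gcongr
    exact B₀.le_opNorm _
  have hs1 : ‖ρ‖⁻¹ * (‖B₀‖ * ‖w.1‖) ≤ ‖B₀‖ * ‖w.1‖ :=
    mul_le_of_le_one_left (by positivity) (inv_le_one_of_one_le₀ hρ1)
  have hs2 : ‖ρ‖⁻¹ * (‖B₀‖ * ‖w.1‖) ≤ μ / 2 * ‖w.1‖ := by
    rw [← mul_assoc]
    gcongr
    rw [inv_mul_le_iff₀ (by linarith)]
    rw [div_le_iff₀ hμ] at hρ2
    linarith
  have hB1 := B₁.le_opNorm w.1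
  have half : ‖(1 / 2 : ℂ)‖ = 1 / 2 := by simp
  have hup : ‖growthPart ρ w‖ ≤ N * ‖w.1‖ := by
    rw [hg, norm_smul, half]
    have h1 := norm_add_le ((1 + B₁) w.1) ((Complex.I * ρ)⁻¹ • B₀ w.1)
    have h2 : ‖(1 + B₁) w.1‖ ≤ ‖w.1‖ + ‖B₁ w.1‖ := norm_add_le _ _
    have : 0 ≤ N * ‖w.1‖ := by positivity
    rw [hN] at this ⊢
    linarith
  have hdn : ‖decayPart ρ w‖ ≤ N * ‖w.1‖ := by
    rw [hd, norm_smul, half]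
    have h1 := norm_sub_le (w.1 - B₁ w.1) ((Complex.I * ρ)⁻¹ • B₀ w.1)
    have h2 : ‖w.1 - B₁ w.1‖ ≤ ‖w.1‖ + ‖B₁ w.1‖ := norm_sub_le _ _
    have : 0 ≤ N * ‖w.1‖ := by positivity
    rw [hN] at this ⊢
    linarith
  have hlow : μ / 4 * ‖w.1‖ ≤ ‖growthPart ρ w‖ := by
    rw [hg, norm_smul, half]
    have h1 := norm_sub_le_norm_add ((1 + B₁) w.1) ((Complex.I * ρ)⁻¹ • B₀ w.1)
    have h2 := hμB w.1
    linarith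
  refine ⟨hdn.trans ?_, hlow, hup⟩
  rw [div_mul_eq_mul_div, mul_div_assoc]
  gcongr
  rw [le_div_iff₀ (by positivity)]
  linarith

theorem exists_decayPart_bounds {B₁ B₀ : E →L[ℂ] E} (hB : IsUnit (1 - B₁)) :
    ∃ κ ≥ 0, ∃ R, ∀ ρ : ℂ, R ≤ ‖ρ‖ → ∀ w : E × E,
      w.2 + ((Complex.I * ρ) • B₁ + B₀) w.1 = 0 →
      ‖growthPart ρ w‖ ≤ κ * ‖decayPart ρ w‖ := by
  rw [sub_eq_add_neg] at hB
  obtain ⟨κ, hκ, _, _, _, _, R, hκR⟩ := exists_growthPart_bounds (B₀ := B₀) hB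
  refine ⟨κ, hκ, R, fun ρ hρ w hw => ?_⟩
  have := (hκR (-ρ) (by rwa [norm_neg]) w (by simpa using hw)).1
  rwa [decayPart_eq_growthPart_neg, neg_neg, ← decayPart_eq_growthPart_neg] at this

theorem exists_boundaryForm_bounds {B₁ B₀ : E →L[ℂ] E} (hB : IsUnit (1 + B₁)) :
    ∃ δ > 0, ∃ ν > 0, ∃ N > 0, ∃ R, ∀ ρ : ℂ, R ≤ ‖ρ‖ → ∀ w : E × E,
      ‖growthPart ρ w‖ ≤ δ * ‖decayPart ρ w‖ →
      ν * (‖ρ‖ * ‖decayPart ρ w‖) ≤ ‖w.2 + ((Complex.I * ρ) • B₁ + B₀) w.1‖ ∧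
        ‖w.2 + ((Complex.I * ρ) • B₁ + B₀) w.1‖ ≤ N * (‖ρ‖ * ‖decayPart ρ w‖) := by
  obtain ⟨μ, hμ, hμB⟩ := exists_pos_mul_norm_le_of_isUnit hB
  set δ := min 1 (μ / (4 * (1 + ‖B₁‖))) with hδ
  have hδ0 : 0 < δ := by positivity
  have hδ1 : δ ≤ 1 := min_le_left _ _
  have hδ2 : (1 + ‖B₁‖) * δ ≤ μ / 4 := by
    have := min_le_right 1 (μ / (4 * (1 + ‖B₁‖)))
    calc (1 + ‖B₁‖) * δ ≤ (1 + ‖B₁‖) * (μ / (4 * (1 + ‖B₁‖))) := by gcongr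
      _ = μ / 4 := by field_simp
  refine ⟨δ, hδ0, μ / 2, by positivity, 2 * (1 + ‖B₁‖ + ‖B₀‖), by positivity,
    max 1 (8 * ‖B₀‖ / μ), fun ρ hρ w hw => ?_⟩
  have hρ1 : 1 ≤ ‖ρ‖ := (le_max_left _ _).trans hρ
  have hρ2 : 8 * ‖B₀‖ / μ ≤ ‖ρ‖ := (le_max_right _ _).trans hρ
  have hρ0 : ρ ≠ 0 := norm_pos_iff.1 (by linarith)
  have hIρ : Complex.I * ρ ≠ 0 := mul_ne_zero Complex.I_ne_zero hρ0
  set a := decayPart ρ w with ha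
  set c := growthPart ρ w with hc
  have hU : w.2 + ((Complex.I * ρ) • B₁ + B₀) w.1 = (Complex.I * ρ) •
      ((1 + B₁) a - (c - B₁ c) + (Complex.I * ρ)⁻¹ • B₀ (a + c)) := by
    rw [← smul_decayPart_sub_growthPart hρ0 w, ← decayPart_add_growthPart ρ w, ← ha, ← hc,
      smul_add (Complex.I * ρ), smul_smul, mul_inv_cancel₀ hIρ]
    simp only [add_apply, smul_apply, map_add, one_apply_eq_self]
    module
  have hn : ‖Complex.I * ρ‖ = ‖ρ‖ := by simp
  rw [hU, norm_smul, hn]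
  have hac : ‖a + c‖ ≤ 2 * ‖a‖ := by
    have h1 := norm_add_le a c
    have h2 : δ * ‖a‖ ≤ ‖a‖ := mul_le_of_le_one_left (norm_nonneg _) hδ1
    linarith
  have hsmall : ‖(Complex.I * ρ)⁻¹ • B₀ (a + c)‖ ≤ ‖ρ‖⁻¹ * (‖B₀‖ * (2 * ‖a‖)) := by
    rw [norm_smul, norm_I_mul_inv]
    gcongr
    exact (B₀.le_opNorm _).trans (by gcongr)
  have hs1 : ‖ρ‖⁻¹ * (‖B₀‖ * (2 * ‖a‖)) ≤ ‖B₀‖ * (2 * ‖a‖) :=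
    mul_le_of_le_one_left (by positivity) (inv_le_one_of_one_le₀ hρ1)
  have hs2 : ‖ρ‖⁻¹ * (‖B₀‖ * (2 * ‖a‖)) ≤ μ / 4 * ‖a‖ := by
    rw [← mul_assoc, ← mul_assoc]
    gcongr
    rw [mul_assoc, inv_mul_le_iff₀ (by linarith)]
    rw [div_le_iff₀ hμ] at hρ2
    linarith
  have hBa : ‖(1 + B₁) a‖ ≤ ‖a‖ + ‖B₁‖ * ‖a‖ := (norm_add_le _ _).trans (by
    gcongr
    · exact le_rfl
    · exact B₁.le_opNorm a)
  have hBc : ‖c - B₁ c‖ ≤ (1 + ‖B₁‖) * (δ * ‖a‖) := by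
    have h1 := norm_sub_le c (B₁ c)
    have h2 := B₁.le_opNorm c
    have h3 : (1 + ‖B₁‖) * ‖c‖ ≤ (1 + ‖B₁‖) * (δ * ‖a‖) := by gcongr
    linarith
  have hBc' : (1 + ‖B₁‖) * (δ * ‖a‖) ≤ μ / 4 * ‖a‖ := by
    rw [← mul_assoc]; gcongr
  have hBc'' : (1 + ‖B₁‖) * (δ * ‖a‖) ≤ (1 + ‖B₁‖) * ‖a‖ := by
    gcongr; exact mul_le_of_le_one_left (norm_nonneg _) hδ1
  have t1 := norm_add_le ((1 + B₁) a - (c - B₁ c)) ((Complex.I * ρ)⁻¹ • B₀ (a + c))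
  have t2 := norm_sub_le_norm_add ((1 + B₁) a - (c - B₁ c)) ((Complex.I * ρ)⁻¹ • B₀ (a + c))
  have t3 := norm_sub_le ((1 + B₁) a) (c - B₁ c)
  have t4 := norm_sub_norm_le ((1 + B₁) a) (c - B₁ c)
  have t5 := hμB a
  constructor
  · rw [mul_left_comm]
    gcongr
    linarith
  · rw [mul_left_comm]
    gcongr
    linarith

namespace SystemPencil

variable (L : SystemPencil E)

/-- The generator of the first-order system. -/
noncomputable def gen (ρ : ℂ) (x : ℝ) : (E × E) →L[ℂ] (E × E) :=
  blockCLM (-L.s x) 1 (-(ρ ^ 2 • 1 + (2 * Complex.I * ρ) • L.q x + L.s x * L.s x)) (L.s x)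

/-- `w = (y, z)` solves the first-order system on `[0, b]`. -/
def IsSol (ρ : ℂ) (b : ℝ) (w : ℝ → E × E) : Prop :=
  ∀ x ∈ Icc 0 b, HasDerivAt w (L.gen ρ x (w x)) x

/-- The boundary form at the left end point. -/
noncomputable def leftForm (ρ : ℂ) (w : E × E) : E :=
  w.2 + ((Complex.I * ρ) • L.h1 + L.h0) w.1

/-- The boundary form at the right end point. -/
noncomputable def rightForm (ρ : ℂ) (w : E × E) : E :=
  w.2 + ((Complex.I * ρ) • L.H1 + L.H0) w.1

/-- The leading coefficients of the boundary forms are nondegenerate. -/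
structure Regular : Prop where
  add_h1 : IsUnit (1 + L.h1)
  sub_h1 : IsUnit (1 - L.h1)
  add_H1 : IsUnit (1 + L.H1)
  sub_H1 : IsUnit (1 - L.H1)

variable {L}

theorem exists_isDichotomous (L : SystemPencil E) (b : ℝ) :
    ∃ K ≥ 0, ∀ ρ : ℂ, 1 ≤ ‖ρ‖ → ∀ w, L.IsSol ρ b w →
      ∃ f g, IsDichotomous ρ K b (fun x => decayPart ρ (w x)) (fun x => growthPart ρ (w x)) f g := by
  obtain ⟨C, hC⟩ := isCompact_Icc.exists_bound_of_continuousOn (s := Icc (0 : ℝ) b)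
    L.continuous_q.continuousOn
  obtain ⟨D, hD⟩ := isCompact_Icc.exists_bound_of_continuousOn (s := Icc (0 : ℝ) b)
    L.continuous_s.continuousOn
  set S := max 0 (max C D) with hS
  have hS0 : 0 ≤ S := le_max_left _ _
  have hq : ∀ x ∈ Icc 0 b, ‖L.q x‖ ≤ S := fun x hx =>
    (hC x hx).trans ((le_max_left _ _).trans (le_max_right _ _))
  have hs : ∀ x ∈ Icc 0 b, ‖L.s x‖ ≤ S := fun x hx =>
    (hD x hx).trans ((le_max_right _ _).trans (le_max_right _ _))
  refine ⟨2 * S + S * S, by positivity, fun ρ hρ w hw => ?_⟩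
  have hρ0 : ρ ≠ 0 := norm_pos_iff.1 (by linarith)
  have hIρ : Complex.I * ρ ≠ 0 := mul_ne_zero Complex.I_ne_zero hρ0
  set Q : ℝ → E := fun x =>
    (2 : ℂ) • L.q x (w x).1 + (Complex.I * ρ)⁻¹ • L.s x (L.s x (w x).1)
      - L.s x (decayPart ρ (w x) - growthPart ρ (w x)) with hQ
  have hnorm : ∀ x ∈ Icc 0 b, ‖L.s x (w x).1‖ + ‖Q x‖ ≤
      2 * ((2 * S + S * S) * (‖decayPart ρ (w x)‖ + ‖growthPart ρ (w x)‖)) := fun x hx => by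
    have hw1 : ‖(w x).1‖ ≤ ‖decayPart ρ (w x)‖ + ‖growthPart ρ (w x)‖ := by
      rw [← decayPart_add_growthPart ρ (w x)]; exact norm_add_le _ _
    set n := ‖decayPart ρ (w x)‖ + ‖growthPart ρ (w x)‖ with hn
    have hn0 : 0 ≤ n := by positivity
    have h1 : ∀ e, ‖e‖ ≤ n → ‖L.s x e‖ ≤ S * n := fun e he => by
      refine ((L.s x).le_opNorm e).trans ?_
      gcongr; exact hs x hx
    have h2 : ‖L.q x (w x).1‖ ≤ S * n := by
      refine ((L.q x).le_opNorm _).trans ?_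
      gcongr; exact hq x hx
    have h3 : ‖L.s x (L.s x (w x).1)‖ ≤ S * (S * n) := by
      refine ((L.s x).le_opNorm _).trans ?_
      gcongr
      · exact hs x hx
      · exact h1 _ hw1
    have h4 : ‖(Complex.I * ρ)⁻¹ • L.s x (L.s x (w x).1)‖ ≤ S * (S * n) := by
      rw [norm_smul, norm_I_mul_inv]
      exact (mul_le_of_le_one_left (norm_nonneg _) (inv_le_one_of_one_le₀ hρ)).trans h3
    have h5 := h1 _ (norm_sub_le (decayPart ρ (w x)) (growthPart ρ (w x)))
    have h6 := h1 _ hw1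
    have h7 : ‖Q x‖ ≤ ‖(2 : ℂ) • L.q x (w x).1‖ + ‖(Complex.I * ρ)⁻¹ • L.s x (L.s x (w x).1)‖
        + ‖L.s x (decayPart ρ (w x) - growthPart ρ (w x))‖ :=
      (norm_sub_le _ _).trans (by gcongr; exact norm_add_le _ _)
    rw [norm_smul, Complex.norm_ofNat] at h7
    have h8 : 0 ≤ S * (S * n) := by positivity
    linarith
  have half : ‖(1 / 2 : ℂ)‖ = 1 / 2 := by simp
  refine ⟨fun x => (1 / 2 : ℂ) • (-L.s x (w x).1 - Q x), fun x => (1 / 2 : ℂ) •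
    (-L.s x (w x).1 + Q x), fun x hx => ?_, fun x hx => ?_, fun x hx => ?_, fun x hx => ?_⟩
  · refine (hasDerivAt_decayPart ρ (hw x hx)).congr_deriv ?_
    have h1 := (decayPart_add_growthPart ρ (w x)).symm
    have h2 := (smul_decayPart_sub_growthPart hρ0 (w x)).symm
    simp only [hQ]
    generalize decayPart ρ (w x) = a at *
    generalize growthPart ρ (w x) = c at *
    simp only [decayPart, gen, blockCLM_apply, neg_apply, add_apply, smul_apply, one_apply_eq_self,
      mul_apply_eq_comp, h1, h2, map_add, map_sub, map_smul]
    match_scalars <;> field_simp <;> (try simp only [Complex.I_sq]) <;> ring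
  · refine (hasDerivAt_growthPart ρ (hw x hx)).congr_deriv ?_
    have h1 := (decayPart_add_growthPart ρ (w x)).symm
    have h2 := (smul_decayPart_sub_growthPart hρ0 (w x)).symm
    simp only [hQ]
    generalize decayPart ρ (w x) = a at *
    generalize growthPart ρ (w x) = c at *
    simp only [growthPart, gen, blockCLM_apply, neg_apply, add_apply, smul_apply, one_apply_eq_self,
      mul_apply_eq_comp, h1, h2, map_add, map_sub, map_smul]
    match_scalars <;> field_simp <;> (try simp only [Complex.I_sq]) <;> ring
  · rw [norm_smul, half]
    have := norm_sub_le (-L.s x (w x).1) (Q x)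
    rw [norm_neg] at this
    linarith [hnorm x hx]
  · rw [norm_smul, half]
    have := norm_add_le (-L.s x (w x).1) (Q x)
    rw [norm_neg] at this
    linarith [hnorm x hx]

theorem exists_growing_solution_bounds (L : SystemPencil E) (hL : L.Regular) {b x₀ δ : ℝ}
    (hx₀ : x₀ ∈ Ioc 0 b) (hδ : 0 < δ) :
    ∃ C > 0, ∃ R, ∀ ρ : ℂ, R ≤ ‖ρ‖ → ‖ρ‖ ≤ 2 * ρ.im → ∀ w, L.IsSol ρ b w →
      L.leftForm ρ (w 0) = 0 →
      ∀ x ∈ Icc x₀ b, ‖decayPart ρ (w x)‖ ≤ δ * ‖growthPart ρ (w x)‖ ∧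
        ‖growthPart ρ (w x)‖ ≤ C * Real.exp (ρ.im * x) * ‖(w 0).1‖ ∧
        ‖(w 0).1‖ ≤ C * Real.exp (-(ρ.im * x)) * ‖growthPart ρ (w x)‖ := by
  obtain ⟨K, hK, hdich⟩ := L.exists_isDichotomous b
  obtain ⟨κ, hκ, ν, hν, N, hN, R₁, h₁⟩ := exists_growthPart_bounds (B₀ := L.h0) hL.add_h1
  obtain ⟨C, hC, R₂, h₂⟩ := exists_growing_bounds (E := E) (κ := κ) hK hδ hx₀
  refine ⟨C * N + C / ν, by positivity, max 1 (max R₁ (2 * R₂)), fun ρ hρ him w hw h0 x hx => ?_⟩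
  have hρ1 : 1 ≤ ‖ρ‖ := (le_max_left _ _).trans hρ
  have hρ2 : R₁ ≤ ‖ρ‖ := ((le_max_left _ _).trans (le_max_right _ _)).trans hρ
  have hρ3 : 2 * R₂ ≤ ‖ρ‖ := ((le_max_right _ _).trans (le_max_right _ _)).trans hρ
  obtain ⟨f, g, hfg⟩ := hdich ρ hρ1 w hw
  obtain ⟨i1, i2, i3⟩ := h₁ ρ hρ2 (w 0) h0
  obtain ⟨j1, j2⟩ := h₂ ρ (by linarith) _ _ _ _ hfg i1
  obtain ⟨k1, k2⟩ := j2 x ⟨hx₀.1.le.trans hx.1, hx.2⟩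
  refine ⟨j1 x hx, k1.trans ?_, ?_⟩
  · calc C * Real.exp (ρ.im * x) * ‖growthPart ρ (w 0)‖
        ≤ C * Real.exp (ρ.im * x) * (N * ‖(w 0).1‖) := by gcongr
      _ = C * N * Real.exp (ρ.im * x) * ‖(w 0).1‖ := by ring
      _ ≤ _ := by gcongr; linarith [div_pos hC hν]
  · calc ‖(w 0).1‖ ≤ ‖growthPart ρ (w 0)‖ / ν := by rw [le_div_iff₀ hν]; linarith
      _ ≤ C * Real.exp (-(ρ.im * x)) * ‖growthPart ρ (w x)‖ / ν := by gcongr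
      _ = C / ν * Real.exp (-(ρ.im * x)) * ‖growthPart ρ (w x)‖ := by ring
      _ ≤ _ := by gcongr; linarith [mul_pos hC hN]

theorem exists_decaying_solution_bounds (L : SystemPencil E) (hL : L.Regular) {b x₀ δ : ℝ}
    (hx₀ : x₀ ∈ Ico 0 b) (hδ : 0 < δ) :
    ∃ C > 0, ∃ R, ∀ ρ : ℂ, R ≤ ‖ρ‖ → ‖ρ‖ ≤ 2 * ρ.im → ∀ w, L.IsSol ρ b w →
      L.rightForm ρ (w b) = 0 →
      ∀ x ∈ Icc 0 x₀, ‖growthPart ρ (w x)‖ ≤ δ * ‖decayPart ρ (w x)‖ ∧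
        ‖ρ‖ * ‖decayPart ρ (w x)‖ ≤ C * Real.exp (-(ρ.im * x)) * ‖L.leftForm ρ (w 0)‖ ∧
        ‖L.leftForm ρ (w 0)‖ ≤ C * Real.exp (ρ.im * x) * (‖ρ‖ * ‖decayPart ρ (w x)‖) := by
  obtain ⟨K, hK, hdich⟩ := L.exists_isDichotomous b
  obtain ⟨κ, hκ, R₁, h₁⟩ := exists_decayPart_bounds (B₀ := L.H0) hL.sub_H1
  obtain ⟨δ', hδ', ν, hν, N, hN, R₃, h₃⟩ := exists_boundaryForm_bounds (B₀ := L.h0) hL.add_h1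
  obtain ⟨C, hC, R₂, h₂⟩ := exists_decaying_bounds (E := E) (κ := κ) hK (lt_min hδ hδ') hx₀
  refine ⟨C * N + C / ν, by positivity, max 1 (max R₁ (max (2 * R₂) R₃)),
    fun ρ hρ him w hw h0 x hx => ?_⟩
  have hρ1 : 1 ≤ ‖ρ‖ := (le_max_left _ _).trans hρ
  have hρ' := (le_max_right _ _).trans hρ
  have hρ2 : R₁ ≤ ‖ρ‖ := (le_max_left _ _).trans hρ'
  have hρ3 : 2 * R₂ ≤ ‖ρ‖ := ((le_max_left _ _).trans (le_max_right _ _)).trans hρ'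
  have hρ4 : R₃ ≤ ‖ρ‖ := ((le_max_right _ _).trans (le_max_right _ _)).trans hρ'
  obtain ⟨f, g, hfg⟩ := hdich ρ hρ1 w hw
  obtain ⟨j1, j2⟩ := h₂ ρ (by linarith) _ _ _ _ hfg (h₁ ρ hρ2 (w b) h0)
  obtain ⟨k1, k2⟩ := j2 x ⟨hx.1, hx.2.trans hx₀.2.le⟩
  obtain ⟨i1, i2⟩ := h₃ ρ hρ4 (w 0) ((j1 0 ⟨le_rfl, hx₀.1⟩).trans (by
    gcongr; exact min_le_right _ _))
  change _ ≤ ‖L.leftForm ρ (w 0)‖ at i1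
  change ‖L.leftForm ρ (w 0)‖ ≤ _ at i2
  refine ⟨(j1 x hx).trans (by gcongr; exact min_le_left _ _), ?_, i2.trans ?_⟩
  · calc ‖ρ‖ * ‖decayPart ρ (w x)‖
        ≤ ‖ρ‖ * (C * Real.exp (-(ρ.im * x)) * ‖decayPart ρ (w 0)‖) := by gcongr
      _ = C * Real.exp (-(ρ.im * x)) * (‖ρ‖ * ‖decayPart ρ (w 0)‖) := by ring
      _ ≤ C * Real.exp (-(ρ.im * x)) * (‖L.leftForm ρ (w 0)‖ / ν) := by
        gcongr; rw [le_div_iff₀ hν]; linarith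
      _ = C / ν * Real.exp (-(ρ.im * x)) * ‖L.leftForm ρ (w 0)‖ := by ring
      _ ≤ _ := by gcongr; linarith [mul_pos hC hN]
  · calc N * (‖ρ‖ * ‖decayPart ρ (w 0)‖)
        ≤ N * (‖ρ‖ * (C * Real.exp (ρ.im * x) * ‖decayPart ρ (w x)‖)) := by gcongr
      _ = C * N * Real.exp (ρ.im * x) * (‖ρ‖ * ‖decayPart ρ (w x)‖) := by ring
      _ ≤ _ := by gcongr; linarith [div_pos hC hν]

end SystemPencil
end SystemPencil

section EntireVanishing

open Filter Complex Asymptotics Bornology in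
/-- An entire function of exponential type that is `O(1/z)` on the diagonals vanishes. -/
theorem eq_zero_of_exponential_type_of_diagonal_decay {G : Type*} [NormedAddCommGroup G]
    [NormedSpace ℂ G] {F : ℂ → G} (hF : Differentiable ℂ F) {A B : ℝ}
    (hexp : ∀ z, 1 ≤ ‖z‖ → ‖F z‖ ≤ A * Real.exp (B * ‖z‖)) {C R : ℝ}
    (hdiag : ∀ z, R ≤ ‖z‖ → |z.re| = |z.im| → ‖F z‖ ≤ C / ‖z‖) (z : ℂ) : F z = 0 := by
  obtain ⟨D, hD⟩ := (isCompact_closedBall (0 : ℂ) (max 1 R)).exists_bound_of_continuousOn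
    hF.continuous.continuousOn
  set M := max D |C| with hM
  have hbd : ∀ z : ℂ, |z.re| = |z.im| → ‖F z‖ ≤ M := fun z hz => by
    rcases le_total ‖z‖ (max 1 R) with h | h
    · exact (hD z (by simpa using h)).trans (le_max_left _ _)
    · have h1 : 1 ≤ ‖z‖ := (le_max_left _ _).trans h
      refine (hdiag z ((le_max_right _ _).trans h) hz).trans (le_trans ?_ (le_max_right _ _))
      rw [div_le_iff₀ (by linarith)]
      nlinarith [le_abs_self C, abs_nonneg C]
  set H : ℂ → G := fun z => F (z * (1 + I)) with hH
  have hHd : Differentiable ℂ H := hF.comp (by fun_prop)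
  have hO : ∀ s : Set ℂ, ∃ c < (2 : ℝ), ∃ B, H =O[cobounded ℂ ⊓ 𝓟 s]
      fun z => Real.exp (B * ‖z‖ ^ c) := fun s => by
    refine ⟨1, by norm_num, B * ‖1 + I‖, IsBigO.of_bound A ?_⟩
    have : ∀ᶠ z : ℂ in cobounded ℂ, 1 ≤ ‖z‖ := tendsto_norm_cobounded_atTop.eventually_ge_atTop 1
    refine (this.filter_mono inf_le_left).mono fun z hz => ?_
    have h1 : 1 ≤ ‖z * (1 + I)‖ := by
      rw [norm_mul]
      have : (1 : ℝ) ≤ ‖(1 + I : ℂ)‖ := by simpa using abs_re_le_norm (1 + I)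
      nlinarith
    refine (hexp _ h1).trans_eq ?_
    rw [Real.norm_eq_abs, Real.abs_exp, Real.rpow_one, norm_mul]
    ring_nf
  have hre : ∀ x : ℝ, ‖H x‖ ≤ M := fun x => hbd _ (by simp)
  have him : ∀ x : ℝ, ‖H (x * I)‖ ≤ M := fun x => hbd _ (by simp)
  have hall : ∀ z, ‖H z‖ ≤ M := fun z => by
    rcases le_total 0 z.re with h | h <;> rcases le_total 0 z.im with h' | h'
    · exact PhragmenLindelof.quadrant_I hHd.diffContOnCl (hO _) (fun x _ => hre x)
        (fun x _ => him x) h h'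
    · exact PhragmenLindelof.quadrant_IV hHd.diffContOnCl (hO _) (fun x _ => hre x)
        (fun x _ => him x) h h'
    · exact PhragmenLindelof.quadrant_II hHd.diffContOnCl (hO _) (fun x _ => hre x)
        (fun x _ => him x) h h'
    · exact PhragmenLindelof.quadrant_III hHd.diffContOnCl (hO _) (fun x _ => hre x)
        (fun x _ => him x) h h'
  have hω : (1 + I : ℂ) ≠ 0 := fun h => by simpa using congrArg re h
  have hconst : ∀ z w, F z = F w := hF.apply_eq_apply_of_bounded (by
    refine isBounded_iff_forall_norm_le.2 ⟨M, ?_⟩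
    rintro _ ⟨z, rfl⟩
    simpa [hH, div_mul_cancel₀ z hω] using hall (z / (1 + I)))
  have hlim : Tendsto (fun x : ℝ => |C| / x) atTop (nhds 0) := tendsto_const_nhds.div_atTop tendsto_id
  refine norm_le_zero_iff.1 (ge_of_tendsto hlim ?_)
  filter_upwards [eventually_ge_atTop (max 1 R)] with x hx
  have hx1 : 1 ≤ x := (le_max_left _ _).trans hx
  have hxn : x ≤ ‖(x : ℂ) * (1 + I)‖ := by simpa using re_le_norm ((x : ℂ) * (1 + I))
  rw [hconst z (x * (1 + I))]
  refine (hdiag _ (((le_max_right _ _).trans hx).trans hxn) (by simp)).trans ?_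
  have h0 : 0 < x := by linarith
  gcongr
  exact le_abs_self C

end EntireVanishing

section Propagator

variable {F : Type*} [NormedAddCommGroup F] [NormedSpace ℂ F]

/-- `W` is the fundamental solution of `w' = A w` on `[0, b]`. -/
structure IsPropagator (A : ℝ → F →L[ℂ] F) (b : ℝ) (W : ℝ → F →L[ℂ] F) : Prop where
  zero : W 0 = 1
  deriv : ∀ x ∈ Icc 0 b, HasDerivAt W (A x * W x) x

/-- `V` is the inverse of the fundamental solution of `w' = A w` on `[0, b]`, as a solution of
the adjoint equation. -/
structure IsCopropagator (A : ℝ → F →L[ℂ] F) (b : ℝ) (V : ℝ → F →L[ℂ] F) : Prop where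
  zero : V 0 = 1
  deriv : ∀ x ∈ Icc 0 b, HasDerivAt V (-(V x * A x)) x

variable {A A' : ℝ → F →L[ℂ] F} {b : ℝ} {W V : ℝ → F →L[ℂ] F}

theorem exists_entire_isPropagator [CompleteSpace F] (hb : 0 ≤ b) {G₀ G₁ G₂ : ℝ → F →L[ℂ] F}
    (h₀ : Continuous G₀) (h₁ : Continuous G₁) (h₂ : Continuous G₂) :
    ∃ W : ℂ → ℝ → F →L[ℂ] F,
      (∀ ρ, IsPropagator (fun x => G₀ x + ρ • G₁ x + ρ ^ 2 • G₂ x) b (W ρ)) ∧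
      ∀ x ∈ Icc 0 b, Differentiable ℂ fun ρ => W ρ x := by
  set m := ContinuousLinearMap.mul ℂ (F →L[ℂ] F) with hm
  obtain ⟨W, h0, hd, he⟩ := exists_entire_solution_linear_ode hb (m.continuous.comp h₀)
    (m.continuous.comp h₁) (m.continuous.comp h₂) 1
  refine ⟨W, fun ρ => ⟨h0 ρ, fun x hx => (hd ρ x hx).congr_deriv ?_⟩, he⟩
  simp [hm, add_mul]

theorem exists_entire_isCopropagator [CompleteSpace F] (hb : 0 ≤ b) {G₀ G₁ G₂ : ℝ → F →L[ℂ] F}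
    (h₀ : Continuous G₀) (h₁ : Continuous G₁) (h₂ : Continuous G₂) :
    ∃ V : ℂ → ℝ → F →L[ℂ] F,
      (∀ ρ, IsCopropagator (fun x => G₀ x + ρ • G₁ x + ρ ^ 2 • G₂ x) b (V ρ)) ∧
      ∀ x ∈ Icc 0 b, Differentiable ℂ fun ρ => V ρ x := by
  set m := -(ContinuousLinearMap.mul ℂ (F →L[ℂ] F)).flip with hm
  obtain ⟨V, h0, hd, he⟩ := exists_entire_solution_linear_ode hb (m.continuous.comp h₀)
    (m.continuous.comp h₁) (m.continuous.comp h₂) 1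
  refine ⟨V, fun ρ => ⟨h0 ρ, fun x hx => (hd ρ x hx).congr_deriv ?_⟩, he⟩
  simp [hm, mul_add]
  abel

theorem hasDerivWithinAt_clm_apply_complex {T : ℝ → F →L[ℂ] F} {T' : F →L[ℂ] F} {w : ℝ → F}
    {w' : F} {s : Set ℝ} {x : ℝ} (hT : HasDerivAt T T' x) (hw : HasDerivWithinAt w w' s x) :
    HasDerivWithinAt (fun x => T x (w x)) (T' (w x) + T x w') s x := by
  have := ((ContinuousLinearMap.restrictScalarsL ℂ F F ℝ ℝ).hasFDerivAt (x := T x)).comp_hasDerivAt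
    x hT
  exact this.hasDerivWithinAt.clm_apply hw

theorem eq_of_hasDerivWithinAt_zero {G : Type*} [NormedAddCommGroup G] [NormedSpace ℝ G] {f : ℝ → G}
    (hf : ∀ x ∈ Icc 0 b, HasDerivWithinAt f 0 (Icc 0 b) x) {x : ℝ} (hx : x ∈ Icc 0 b) :
    f x = f 0 := by
  refine constant_of_has_deriv_right_zero (fun x hx => (hf x hx).continuousWithinAt)
    (fun x hx => ?_) x hx
  exact ((hf x (Ico_subset_Icc_self hx)).mono_of_mem_nhdsWithin (Icc_mem_nhdsGE_of_mem hx))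

theorem IsPropagator.hasDerivAt_apply (hW : IsPropagator A b W) (w₀ : F) {x : ℝ}
    (hx : x ∈ Icc 0 b) : HasDerivAt (fun x => W x w₀) (A x (W x w₀)) x := by
  have := hasDerivWithinAt_clm_apply_complex (s := univ) (hW.deriv x hx)
    (hasDerivWithinAt_const x univ w₀)
  rw [hasDerivWithinAt_univ] at this
  simpa using this

/-- A solution on `[0, b]`, one-sided at the end points, is propagated from its value at `0`. -/
theorem IsCopropagator.apply_eq (hV : IsCopropagator A b V) {w : ℝ → F}
    (hw : ∀ x ∈ Icc 0 b, HasDerivWithinAt w (A x (w x)) (Icc 0 b) x) {x : ℝ}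
    (hx : x ∈ Icc 0 b) : V x (w x) = w 0 := by
  have := eq_of_hasDerivWithinAt_zero (f := fun x => V x (w x)) (fun x hx =>
    (hasDerivWithinAt_clm_apply_complex (hV.deriv x hx) (hw x hx)).congr_deriv (by simp)) hx
  simpa [hV.zero] using this

theorem IsPropagator.copropagator_mul (hW : IsPropagator A b W) (hV : IsCopropagator A b V) {x : ℝ}
    (hx : x ∈ Icc 0 b) : V x * W x = 1 := by
  refine ContinuousLinearMap.ext fun w₀ => ?_
  have := hV.apply_eq (fun x hx => (hW.hasDerivAt_apply w₀ hx).hasDerivWithinAt) hx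
  simpa [hW.zero] using this

theorem IsPropagator.mul_copropagator [FiniteDimensional ℂ F] (hW : IsPropagator A b W)
    (hV : IsCopropagator A b V) {x : ℝ} (hx : x ∈ Icc 0 b) : W x * V x = 1 := by
  have h := congrArg ContinuousLinearMap.toLinearMap (hW.copropagator_mul hV hx)
  exact ContinuousLinearMap.coe_injective ((LinearMap.comp_eq_id_comm ℂ F).1 h)

theorem hasDerivAt_propagator_mul_copropagator (hW : IsPropagator A b W)
    (hV : IsCopropagator A' b V) (N : F →L[ℂ] F) (w₀ : F) {x : ℝ} (hx : x ∈ Icc 0 b) :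
    HasDerivAt (fun x => W x (N (V x w₀))) (A x (W x (N (V x w₀))) - W x (N (V x (A' x w₀)))) x := by
  have h1 := hasDerivWithinAt_clm_apply_complex (s := univ) (hV.deriv x hx)
    (hasDerivWithinAt_const x univ w₀)
  have h2 := (N.restrictScalars ℝ).hasFDerivAt.comp_hasDerivWithinAt x h1
  have h3 := hasDerivWithinAt_clm_apply_complex (hW.deriv x hx) h2
  rw [hasDerivWithinAt_univ] at h3
  refine h3.congr_deriv ?_
  simp [sub_eq_add_neg]

theorem IsPropagator.norm_le (hW : IsPropagator A b W) {K : ℝ} (hK : ∀ x ∈ Icc 0 b, ‖A x‖ ≤ K)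
    {x : ℝ} (hx : x ∈ Icc 0 b) : ‖W x‖ ≤ Real.exp (K * x) := by
  have := norm_le_gronwallBound_of_norm_deriv_right_le (f := W) (δ := 1) (K := K) (ε := 0)
    (fun x hx => (hW.deriv x hx).continuousAt.continuousWithinAt)
    (fun x hx => (hW.deriv x (Ico_subset_Icc_self hx)).hasDerivWithinAt)
    (by rw [hW.zero]; exact ContinuousLinearMap.norm_id_le)
    (fun x hx => by
      rw [add_zero]
      exact (norm_mul_le _ _).trans (by gcongr; exact hK x (Ico_subset_Icc_self hx))) x hx
  simpa [gronwallBound_ε0] using this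

theorem IsCopropagator.norm_le (hV : IsCopropagator A b V) {K : ℝ}
    (hK : ∀ x ∈ Icc 0 b, ‖A x‖ ≤ K) {x : ℝ} (hx : x ∈ Icc 0 b) : ‖V x‖ ≤ Real.exp (K * x) := by
  have := norm_le_gronwallBound_of_norm_deriv_right_le (f := V) (δ := 1) (K := K) (ε := 0)
    (fun x hx => (hV.deriv x hx).continuousAt.continuousWithinAt)
    (fun x hx => (hV.deriv x (Ico_subset_Icc_self hx)).hasDerivWithinAt)
    (by rw [hV.zero]; exact ContinuousLinearMap.norm_id_le)
    (fun x hx => by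
      rw [add_zero, norm_neg, mul_comm K]
      exact (norm_mul_le _ _).trans (by gcongr; exact hK x (Ico_subset_Icc_self hx))) x hx
  simpa [gronwallBound_ε0] using this

theorem IsPropagator.conj (hW : IsPropagator A b W) {D D' : F →L[ℂ] F} (h : D * D' = 1)
    (h' : D' * D = 1) : IsPropagator (fun x => D * A x * D') b (fun x => D * W x * D') where
  zero := by simp [hW.zero, h]
  deriv x hx := by
    refine (((hW.deriv x hx).const_mul D).mul_const D').congr_deriv ?_
    simp only [mul_assoc]
    rw [← mul_assoc D' D, h', one_mul]

theorem IsCopropagator.conj (hV : IsCopropagator A b V) {D D' : F →L[ℂ] F} (h : D * D' = 1)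
    (h' : D' * D = 1) : IsCopropagator (fun x => D * A x * D') b (fun x => D * V x * D') where
  zero := by simp [hV.zero, h]
  deriv x hx := by
    refine (((hV.deriv x hx).const_mul D).mul_const D').congr_deriv ?_
    simp only [mul_assoc, mul_neg, neg_mul]
    rw [← mul_assoc D' D, h', one_mul]

end Propagator

namespace SystemPencil

variable {E : Type*} [NormedAddCommGroup E] [InnerProductSpace ℂ E]
variable {L : SystemPencil E} {ρ : ℂ} {b : ℝ}

theorem continuous_blockCLM {A B C D : ℝ → E →L[ℂ] E} (hA : Continuous A) (hB : Continuous B)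
    (hC : Continuous C) (hD : Continuous D) :
    Continuous fun x => blockCLM (A x) (B x) (C x) (D x) := by
  have : (fun x => blockCLM (A x) (B x) (C x) (D x)) = fun x =>
      ContinuousLinearMap.inl ℂ E E ∘L
        (A x ∘L ContinuousLinearMap.fst ℂ E E + B x ∘L ContinuousLinearMap.snd ℂ E E)
      + ContinuousLinearMap.inr ℂ E E ∘L
        (C x ∘L ContinuousLinearMap.fst ℂ E E + D x ∘L ContinuousLinearMap.snd ℂ E E) := by
    ext x w <;> simp [blockCLM]
  rw [this]
  fun_prop

theorem gen_eq (L : SystemPencil E) (ρ : ℂ) (x : ℝ) :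
    L.gen ρ x = blockCLM (-L.s x) 1 (-(L.s x * L.s x)) (L.s x)
      + ρ • blockCLM 0 0 (-((2 * Complex.I) • L.q x)) 0 + ρ ^ 2 • blockCLM 0 0 (-1) 0 := by
  ext w
  all_goals simp [gen]
  all_goals module

theorem exists_entire_fundamental [CompleteSpace E] (L : SystemPencil E) (hb : 0 ≤ b) :
    ∃ W V : ℂ → ℝ → (E × E) →L[ℂ] (E × E), (∀ ρ, IsPropagator (L.gen ρ) b (W ρ)) ∧
      (∀ ρ, IsCopropagator (L.gen ρ) b (V ρ)) ∧
      (∀ x ∈ Icc 0 b, Differentiable ℂ fun ρ => W ρ x) ∧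
      ∀ x ∈ Icc 0 b, Differentiable ℂ fun ρ => V ρ x := by
  have cz : Continuous fun _ : ℝ => (0 : E →L[ℂ] E) := continuous_const
  have c0 := continuous_blockCLM L.continuous_s.neg (continuous_const (y := (1 : E →L[ℂ] E)))
    (L.continuous_s.mul L.continuous_s).neg L.continuous_s
  have c1 := continuous_blockCLM cz cz (L.continuous_q.const_smul (2 * Complex.I)).neg cz
  have c2 := continuous_blockCLM cz cz (continuous_const (y := (-1 : E →L[ℂ] E))) cz
  obtain ⟨W, hW, hW'⟩ := exists_entire_isPropagator hb c0 c1 c2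
  obtain ⟨V, hV, hV'⟩ := exists_entire_isCopropagator hb c0 c1 c2
  have : ∀ ρ, L.gen ρ = _ := fun ρ => funext fun x => gen_eq L ρ x
  refine ⟨W, V, fun ρ => ?_, fun ρ => ?_, hW', hV'⟩
  · rw [this]; exact hW ρ
  · rw [this]; exact hV ρ

theorem isSol_apply {W : ℝ → (E × E) →L[ℂ] (E × E)} (hW : IsPropagator (L.gen ρ) b W)
    (w₀ : E × E) : L.IsSol ρ b fun x => W x w₀ := fun _ hx => hW.hasDerivAt_apply w₀ hx

theorem IsSol.sub {w w' : ℝ → E × E} (hw : L.IsSol ρ b w) (hw' : L.IsSol ρ b w') :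
    L.IsSol ρ b (w - w') := fun x hx => by
  refine ((hw x hx).sub (hw' x hx)).congr_deriv ?_
  simp

theorem norm_blockCLM_le (A B C D : E →L[ℂ] E) :
    ‖blockCLM A B C D‖ ≤ ‖A‖ + ‖B‖ + ‖C‖ + ‖D‖ := by
  refine ContinuousLinearMap.opNorm_le_bound _ (by positivity) fun w => ?_
  have h1 : ‖w.1‖ ≤ ‖w‖ := norm_fst_le w
  have h2 : ‖w.2‖ ≤ ‖w‖ := norm_snd_le w
  have hA : ‖A w.1‖ ≤ ‖A‖ * ‖w‖ := A.le_opNorm_of_le h1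
  have hB : ‖B w.2‖ ≤ ‖B‖ * ‖w‖ := B.le_opNorm_of_le h2
  have hC : ‖C w.1‖ ≤ ‖C‖ * ‖w‖ := C.le_opNorm_of_le h1
  have hD : ‖D w.2‖ ≤ ‖D‖ * ‖w‖ := D.le_opNorm_of_le h2
  have pA : 0 ≤ ‖A‖ * ‖w‖ := by positivity
  have pB : 0 ≤ ‖B‖ * ‖w‖ := by positivity
  have pC : 0 ≤ ‖C‖ * ‖w‖ := by positivity
  have pD : 0 ≤ ‖D‖ * ‖w‖ := by positivity
  rw [blockCLM_apply, Prod.norm_def]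
  refine max_le ?_ ?_
  · have := norm_add_le (A w.1) (B w.2)
    simp only
    linarith
  · have := norm_add_le (C w.1) (D w.2)
    simp only
    linarith

/-- The fundamental solution and its inverse are of exponential type in `ρ`. -/
theorem exists_norm_propagator_le (L : SystemPencil E) (b : ℝ) :
    ∃ K, ∀ ρ : ℂ, 1 ≤ ‖ρ‖ → ∀ x ∈ Icc 0 b,
      (∀ W, IsPropagator (L.gen ρ) b W → ‖W x‖ ≤ Real.exp (K * ‖ρ‖)) ∧
      ∀ V, IsCopropagator (L.gen ρ) b V → ‖V x‖ ≤ Real.exp (K * ‖ρ‖) := by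
  obtain ⟨C, hC⟩ := isCompact_Icc.exists_bound_of_continuousOn (s := Icc (0 : ℝ) b)
    L.continuous_q.continuousOn
  obtain ⟨S, hS⟩ := isCompact_Icc.exists_bound_of_continuousOn (s := Icc (0 : ℝ) b)
    L.continuous_s.continuousOn
  set K := 2 + 2 * C + S * S + 2 * S with hK
  refine ⟨4 + K * b, fun ρ hρ x hx => ?_⟩
  have hb : 0 ≤ b := hx.1.trans hx.2
  have hC0 : 0 ≤ C := (norm_nonneg _).trans (hC x hx)
  have hS0 : 0 ≤ S := (norm_nonneg _).trans (hS x hx)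
  have hρ0 : ρ ≠ 0 := norm_pos_iff.1 (by linarith)
  have hinv : ‖ρ‖⁻¹ ≤ 1 := inv_le_one_of_one_le₀ hρ
  have hone : ‖(1 : E →L[ℂ] E)‖ ≤ 1 := ContinuousLinearMap.norm_id_le
  set D : (E × E) →L[ℂ] (E × E) := blockCLM 1 0 0 (ρ⁻¹ • 1) with hD
  set D' : (E × E) →L[ℂ] (E × E) := blockCLM 1 0 0 (ρ • 1) with hD'
  have hDD : D * D' = 1 := by
    refine ContinuousLinearMap.ext fun w => ?_
    simp [hD, hD', smul_smul, hρ0]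
  have hDD' : D' * D = 1 := by
    refine ContinuousLinearMap.ext fun w => ?_
    simp [hD, hD', smul_smul, hρ0]
  have hDn : ‖D‖ ≤ 2 * ‖ρ‖ := by
    refine (norm_blockCLM_le _ _ _ _).trans ?_
    rw [norm_smul, norm_inv, norm_zero]
    have : ‖ρ‖⁻¹ * ‖(1 : E →L[ℂ] E)‖ ≤ 1 := mul_le_one₀ hinv (norm_nonneg _) hone
    linarith
  have hDn' : ‖D'‖ ≤ 2 * ‖ρ‖ := by
    refine (norm_blockCLM_le _ _ _ _).trans ?_
    rw [norm_smul, norm_zero]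
    have : ‖ρ‖ * ‖(1 : E →L[ℂ] E)‖ ≤ ‖ρ‖ := mul_le_of_le_one_right (norm_nonneg _) hone
    linarith
  have hA : ∀ x ∈ Icc 0 b, ‖D * L.gen ρ x * D'‖ ≤ K * ‖ρ‖ := fun x hx => by
    have : D * L.gen ρ x * D' = blockCLM (-L.s x) (ρ • 1)
        (-(ρ • 1 + (2 * Complex.I) • L.q x + ρ⁻¹ • (L.s x * L.s x))) (L.s x) := by
      refine ContinuousLinearMap.ext fun w => Prod.ext ?_ ?_
      · simp [hD, hD', gen]
      · simp only [hD, hD', gen, mul_apply_eq_comp, blockCLM_apply, add_apply, neg_apply,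
          smul_apply, one_apply_eq_self, zero_apply, map_smul, add_zero, zero_add]
        match_scalars <;> field_simp
    rw [this]
    refine (norm_blockCLM_le _ _ _ _).trans ?_
    have hs := hS x hx
    have hq := hC x hx
    have hss : ‖ρ⁻¹ • (L.s x * L.s x)‖ ≤ S * S := by
      rw [norm_smul, norm_inv]
      refine (mul_le_of_le_one_left (norm_nonneg _) hinv).trans ((norm_mul_le _ _).trans ?_)
      gcongr
    have h1 : ‖ρ • (1 : E →L[ℂ] E)‖ ≤ ‖ρ‖ := by
      rw [norm_smul]; exact mul_le_of_le_one_right (norm_nonneg _) hone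
    have hqq : ‖(2 * Complex.I) • L.q x‖ ≤ 2 * C := by
      rw [norm_smul]; simpa using hq
    have h3 := norm_add_le (ρ • (1 : E →L[ℂ] E) + (2 * Complex.I) • L.q x)
      (ρ⁻¹ • (L.s x * L.s x))
    have h4 := norm_add_le (ρ • (1 : E →L[ℂ] E)) ((2 * Complex.I) • L.q x)
    rw [norm_neg, norm_neg]
    have h5 : (2 * C + S * S + 2 * S) * 1 ≤ (2 * C + S * S + 2 * S) * ‖ρ‖ := by gcongr
    linarith
  have hfin : ∀ T : (E × E) →L[ℂ] (E × E), ‖D * T * D'‖ ≤ Real.exp (K * ‖ρ‖ * x) →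
      ‖T‖ ≤ Real.exp ((4 + K * b) * ‖ρ‖) := fun T hT => by
    have hTe : T = D' * (D * T * D') * D := by
      rw [show D' * (D * T * D') * D = (D' * D) * T * (D' * D) by simp only [mul_assoc], hDD',
        one_mul, mul_one]
    have hK0 : 0 ≤ K := by positivity
    have hexp : 2 * ‖ρ‖ ≤ Real.exp (2 * ‖ρ‖) := by linarith [Real.add_one_le_exp (2 * ‖ρ‖)]
    rw [hTe]
    calc ‖D' * (D * T * D') * D‖ ≤ ‖D'‖ * ‖D * T * D'‖ * ‖D‖ :=
          (norm_mul_le (D' * (D * T * D')) D).trans (by gcongr; exact norm_mul_le D' (D * T * D'))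
      _ ≤ Real.exp (2 * ‖ρ‖) * Real.exp (K * ‖ρ‖ * b) * Real.exp (2 * ‖ρ‖) := by
          gcongr
          · exact hDn'.trans hexp
          · refine hT.trans ?_
            gcongr
            exact hx.2
          · exact hDn.trans hexp
      _ = Real.exp ((4 + K * b) * ‖ρ‖) := by
          rw [← Real.exp_add, ← Real.exp_add]; ring_nf
  exact ⟨fun W hW => hfin _ ((hW.conj hDD hDD').norm_le hA hx),
    fun V hV => hfin _ ((hV.conj hDD hDD').norm_le hA hx)⟩

end SystemPencil

namespace SystemPencil

variable {E : Type*} [NormedAddCommGroup E] [InnerProductSpace ℂ E]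
variable {L L' : SystemPencil E} {ρ : ℂ} {b : ℝ}

theorem leftForm_sub (L : SystemPencil E) (ρ : ℂ) (w w' : E × E) :
    L.leftForm ρ (w - w') = L.leftForm ρ w - L.leftForm ρ w' := by
  simp only [leftForm, Prod.fst_sub, Prod.snd_sub, map_sub]
  abel

/-- `M` maps `d` to the initial value of a solution with left form `d` and right form zero. -/
def IsWeyl (L : SystemPencil E) (ρ : ℂ) (b : ℝ) (M : E →L[ℂ] E) : Prop :=
  ∀ d, ∃ w, L.IsSol ρ b w ∧ (w 0).1 = M d ∧ L.leftForm ρ (w 0) = d ∧ L.rightForm ρ (w b) = 0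

theorem IsWeyl.exists_split {M : E →L[ℂ] E} (hM : L.IsWeyl ρ b M) {w : ℝ → E × E}
    (hw : L.IsSol ρ b w) :
    ∃ u v, L.IsSol ρ b u ∧ L.IsSol ρ b v ∧ (∀ x, w x = u x + v x) ∧ L.leftForm ρ (u 0) = 0 ∧
      (u 0).1 = (w 0).1 - M (L.leftForm ρ (w 0)) ∧
      L.leftForm ρ (v 0) = L.leftForm ρ (w 0) ∧ L.rightForm ρ (v b) = 0 := by
  obtain ⟨v, hv, hv1, hv2, hv3⟩ := hM (L.leftForm ρ (w 0))
  refine ⟨w - v, v, hw.sub hv, hv, fun x => by simp, ?_, ?_, hv2, hv3⟩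
  · rw [Pi.sub_apply, leftForm_sub, hv2, sub_self]
  · simp [hv1]

theorem norm_fst_add_le (ρ : ℂ) (u v : E × E) {δ : ℝ} (hδ : δ ≤ 1)
    (hu : ‖decayPart ρ u‖ ≤ δ * ‖growthPart ρ u‖) (hv : ‖growthPart ρ v‖ ≤ δ * ‖decayPart ρ v‖) :
    ‖(u + v).1‖ ≤ 2 * (‖growthPart ρ u‖ + ‖decayPart ρ v‖) := by
  rw [← decayPart_add_growthPart ρ, decayPart_add, growthPart_add]
  have h1 := norm_add_le (decayPart ρ u + decayPart ρ v) (growthPart ρ u + growthPart ρ v)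
  have h2 := norm_add_le (decayPart ρ u) (decayPart ρ v)
  have h3 := norm_add_le (growthPart ρ u) (growthPart ρ v)
  nlinarith [norm_nonneg (growthPart ρ u), norm_nonneg (decayPart ρ v)]

theorem norm_parts_le {u v : E × E} (huv : (u + v).1 = 0)
    (hu : ‖decayPart ρ u‖ ≤ 1 / 2 * ‖growthPart ρ u‖)
    (hv : ‖growthPart ρ v‖ ≤ 1 / 2 * ‖decayPart ρ v‖) :
    ‖growthPart ρ u‖ + ‖decayPart ρ v‖ ≤ 2 * ‖(u + v).2‖ / ‖ρ‖ := by
  have h1 : ‖decayPart ρ (u + v)‖ = 1 / 2 * (‖(u + v).2‖ / ‖ρ‖) := by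
    rw [decayPart, huv, zero_add, norm_smul, norm_smul, norm_I_mul_inv, div_eq_inv_mul ‖(u + v).2‖]
    simp
  have h2 : ‖growthPart ρ (u + v)‖ = 1 / 2 * (‖(u + v).2‖ / ‖ρ‖) := by
    rw [growthPart, huv, zero_sub, norm_smul, norm_neg, norm_smul, norm_I_mul_inv,
      div_eq_inv_mul ‖(u + v).2‖]
    simp
  rw [decayPart_add] at h1
  rw [growthPart_add] at h2
  have h3 := norm_sub_le_norm_add (growthPart ρ u) (growthPart ρ v)
  have h4 := norm_sub_le_norm_add (decayPart ρ v) (decayPart ρ u)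
  rw [add_comm (decayPart ρ v)] at h4
  rw [mul_div_assoc]
  linarith

/-- Solutions of two pencils with a common Weyl function are comparable: if the second vanishes at
`x`, then the first is small there. -/
theorem exists_norm_fst_le (hL : L.Regular) (hL' : L'.Regular) {x : ℝ} (hx : x ∈ Ioo 0 b) :
    ∃ C R, ∀ ρ : ℂ, R ≤ ‖ρ‖ → ‖ρ‖ ≤ 2 * ρ.im → ∀ M, L.IsWeyl ρ b M → L'.IsWeyl ρ b M →
      ∀ w w', L.IsSol ρ b w → L'.IsSol ρ b w' → (w 0).1 = (w' 0).1 →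
      L.leftForm ρ (w 0) = L'.leftForm ρ (w' 0) → (w' x).1 = 0 →
      ‖(w x).1‖ ≤ C / ‖ρ‖ * ‖(w' x).2‖ := by
  have hx1 : x ∈ Ioc 0 b := ⟨hx.1, hx.2.le⟩
  have hx2 : x ∈ Ico 0 b := ⟨hx.1.le, hx.2⟩
  obtain ⟨C₁, hC₁, R₁, h₁⟩ := L.exists_growing_solution_bounds hL hx1 one_half_pos
  obtain ⟨C₂, hC₂, R₂, h₂⟩ := L'.exists_growing_solution_bounds hL' hx1 one_half_pos
  obtain ⟨C₃, hC₃, R₃, h₃⟩ := L.exists_decaying_solution_bounds hL hx2 one_half_pos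
  obtain ⟨C₄, hC₄, R₄, h₄⟩ := L'.exists_decaying_solution_bounds hL' hx2 one_half_pos
  refine ⟨4 * (C₁ * C₂ + C₃ * C₄), max 1 (max (max R₁ R₂) (max R₃ R₄)),
    fun ρ hρ him M hM hM' w w' hw hw' hw0 hd hz => ?_⟩
  simp only [max_le_iff] at hρ
  obtain ⟨hρ1, ⟨hR1, hR2⟩, hR3, hR4⟩ := hρ
  have hρpos : 0 < ‖ρ‖ := by linarith
  obtain ⟨u, v, hu, hv, huv, hu0, hu1, hv0, hvb⟩ := hM.exists_split hw
  obtain ⟨u', v', hu', hv', huv', hu0', hu1', hv0', hvb'⟩ := hM'.exists_split hw'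
  obtain ⟨a1, a2, -⟩ := h₁ ρ hR1 him u hu hu0 x ⟨le_rfl, hx.2.le⟩
  obtain ⟨b1, -, b3⟩ := h₂ ρ hR2 him u' hu' hu0' x ⟨le_rfl, hx.2.le⟩
  obtain ⟨c1, c2, -⟩ := h₃ ρ hR3 him v hv hvb x ⟨hx.1.le, le_rfl⟩
  obtain ⟨d1, -, d3⟩ := h₄ ρ hR4 him v' hv' hvb' x ⟨hx.1.le, le_rfl⟩
  have hee : Real.exp (ρ.im * x) * Real.exp (-(ρ.im * x)) = 1 := by
    rw [← Real.exp_add, add_neg_cancel, Real.exp_zero]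
  have hgrow : ‖growthPart ρ (u x)‖ ≤ C₁ * C₂ * ‖growthPart ρ (u' x)‖ := by
    rw [show (u 0).1 = (u' 0).1 by rw [hu1, hu1', hw0, hd]] at a2
    calc _ ≤ _ := a2
      _ ≤ C₁ * Real.exp (ρ.im * x) * (C₂ * Real.exp (-(ρ.im * x)) * ‖growthPart ρ (u' x)‖) := by
        gcongr
      _ = C₁ * C₂ * (Real.exp (ρ.im * x) * Real.exp (-(ρ.im * x))) * ‖growthPart ρ (u' x)‖ := by
        ring
      _ = _ := by rw [hee, mul_one]
  have hdec : ‖decayPart ρ (v x)‖ ≤ C₃ * C₄ * ‖decayPart ρ (v' x)‖ := by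
    rw [hv0, hd, ← hv0'] at c2
    refine le_of_mul_le_mul_left ?_ hρpos
    calc _ ≤ _ := c2
      _ ≤ C₃ * Real.exp (-(ρ.im * x)) *
          (C₄ * Real.exp (ρ.im * x) * (‖ρ‖ * ‖decayPart ρ (v' x)‖)) := by gcongr
      _ = C₃ * C₄ * (Real.exp (ρ.im * x) * Real.exp (-(ρ.im * x))) *
          (‖ρ‖ * ‖decayPart ρ (v' x)‖) := by ring
      _ = _ := by rw [hee]; ring
  have e1 := norm_fst_add_le ρ (u x) (v x) (by norm_num) a1 c1
  have e2 := norm_parts_le (ρ := ρ) (by rw [← huv', hz]) b1 d1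
  rw [← huv] at e1
  rw [← huv'] at e2
  calc ‖(w x).1‖ ≤ _ := e1
    _ ≤ 2 * ((C₁ * C₂ + C₃ * C₄) * (‖growthPart ρ (u' x)‖ + ‖decayPart ρ (v' x)‖)) := by
      have p1 : 0 ≤ C₁ * C₂ * ‖decayPart ρ (v' x)‖ := by positivity
      have p2 : 0 ≤ C₃ * C₄ * ‖growthPart ρ (u' x)‖ := by positivity
      linarith
    _ ≤ 2 * ((C₁ * C₂ + C₃ * C₄) * (2 * ‖(w' x).2‖ / ‖ρ‖)) := by gcongr
    _ = _ := by ring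

/-- Far from the real axis the only solution satisfying both boundary conditions is zero. -/
theorem exists_fst_eq_zero (hL : L.Regular) (hb : 0 < b) :
    ∃ R, ∀ ρ : ℂ, R ≤ ‖ρ‖ → ‖ρ‖ ≤ 2 * ρ.im → ∀ w, L.IsSol ρ b w → L.leftForm ρ (w 0) = 0 →
      L.rightForm ρ (w b) = 0 → (w 0).1 = 0 := by
  obtain ⟨κ, hκ, R₁, h₁⟩ := exists_decayPart_bounds (B₀ := L.H0) hL.sub_H1
  obtain ⟨C, hC, R₂, h₂⟩ := L.exists_growing_solution_bounds hL (x₀ := b) (b := b)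
    (δ := 1 / (2 * (κ + 1))) ⟨hb, le_rfl⟩ (by positivity)
  refine ⟨max R₁ R₂, fun ρ hρ him w hw h0 h1 => ?_⟩
  obtain ⟨a1, -, a3⟩ := h₂ ρ ((le_max_right _ _).trans hρ) him w hw h0 b ⟨le_rfl, le_rfl⟩
  have a4 := h₁ ρ ((le_max_left _ _).trans hρ) (w b) h1
  have hg : ‖growthPart ρ (w b)‖ ≤ 1 / 2 * ‖growthPart ρ (w b)‖ := by
    refine a4.trans ?_
    calc κ * ‖decayPart ρ (w b)‖ ≤ (κ + 1) * (1 / (2 * (κ + 1)) * ‖growthPart ρ (w b)‖) := by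
          gcongr; linarith
      _ = _ := by field_simp
  have hg0 : ‖growthPart ρ (w b)‖ = 0 := le_antisymm (by linarith) (norm_nonneg _)
  rw [hg0, mul_zero] at a3
  exact norm_le_zero_iff.1 a3

theorem exists_isWeyl [FiniteDimensional ℂ E] (hL : L.Regular) (hb : 0 < b) :
    ∃ R, ∀ ρ : ℂ, R ≤ ‖ρ‖ → ‖ρ‖ ≤ 2 * ρ.im → ∃ M, L.IsWeyl ρ b M := by
  have : CompleteSpace E := FiniteDimensional.complete ℂ E
  obtain ⟨R, hR⟩ := exists_fst_eq_zero hL hb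
  obtain ⟨W, -, hW, -⟩ := L.exists_entire_fundamental hb.le
  refine ⟨R, fun ρ hρ him => ?_⟩
  set h : E →L[ℂ] E := (Complex.I * ρ) • L.h1 + L.h0 with hh
  set H : E →L[ℂ] E := (Complex.I * ρ) • L.H1 + L.H0 with hH
  set V : (E × E) →L[ℂ] E := ContinuousLinearMap.snd ℂ E E + H ∘L ContinuousLinearMap.fst ℂ E E
    with hV
  set P : E →L[ℂ] E := V ∘L W ρ b ∘L (ContinuousLinearMap.id ℂ E).prod (-h) with hP
  have hinj : Function.Injective (P : E →ₗ[ℂ] E) := by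
    refine (injective_iff_map_eq_zero _).2 fun c hc => ?_
    have := hR ρ hρ him _ (isSol_apply (hW ρ) (c, -h c))
      (by simp [(hW ρ).zero, leftForm, hh]) hc
    simpa [(hW ρ).zero] using this
  set e := LinearEquiv.ofInjectiveEndo _ hinj with he
  set M : E →L[ℂ] E := -(LinearMap.toContinuousLinearMap (e.symm : E →ₗ[ℂ] E) ∘L V ∘L W ρ b ∘L
    ContinuousLinearMap.inr ℂ E E) with hM
  refine ⟨M, fun d => ⟨fun x => W ρ x (M d, d - h (M d)), isSol_apply (hW ρ) _, ?_, ?_, ?_⟩⟩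
  · simp [(hW ρ).zero]
  · simp [(hW ρ).zero, leftForm, hh]
  · have h1 : ((M d, d - h (M d)) : E × E) = (0, d) + (M d, -h (M d)) := by simp [sub_eq_add_neg]
    have h2 : P (M d) = -V (W ρ b (0, d)) := by
      have : (P : E →ₗ[ℂ] E) (e.symm (V (W ρ b (0, d)))) = V (W ρ b (0, d)) :=
        LinearEquiv.apply_symm_apply e _
      simp only [hM, neg_apply, map_neg, ContinuousLinearMap.comp_apply,
        ContinuousLinearMap.inr_apply]
      exact congrArg Neg.neg this
    change V (W ρ b _) = 0
    rw [h1, map_add, map_add]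
    change V (W ρ b (0, d)) + P (M d) = 0
    rw [h2, add_neg_cancel]

end SystemPencil

namespace SystemPencil

variable {E : Type*} [NormedAddCommGroup E] [InnerProductSpace ℂ E]
variable {L L' : SystemPencil E} {ρ : ℂ} {b : ℝ}

/-- The pencil obtained by the substitution `ρ ↦ -ρ`. -/
noncomputable def reflect (L : SystemPencil E) : SystemPencil E where
  q x := -L.q x
  s := L.s
  h1 := -L.h1
  h0 := L.h0
  H1 := -L.H1
  H0 := L.H0
  continuous_q := L.continuous_q.neg
  continuous_s := L.continuous_s

theorem reflect_gen (L : SystemPencil E) (ρ : ℂ) : L.reflect.gen ρ = L.gen (-ρ) := by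
  ext x w <;> simp [gen, reflect]

theorem reflect_leftForm (L : SystemPencil E) (ρ : ℂ) : L.reflect.leftForm ρ = L.leftForm (-ρ) := by
  ext w; simp [leftForm, reflect]

theorem reflect_rightForm (L : SystemPencil E) (ρ : ℂ) :
    L.reflect.rightForm ρ = L.rightForm (-ρ) := by
  ext w; simp [rightForm, reflect]

theorem reflect_isSol (L : SystemPencil E) (ρ : ℂ) (b : ℝ) (w : ℝ → E × E) :
    L.reflect.IsSol ρ b w ↔ L.IsSol (-ρ) b w := by
  simp only [IsSol, reflect_gen]

theorem reflect_isWeyl (L : SystemPencil E) (ρ : ℂ) (b : ℝ) (M : E →L[ℂ] E) :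
    L.reflect.IsWeyl ρ b M ↔ L.IsWeyl (-ρ) b M := by
  simp only [IsWeyl, reflect_isSol, reflect_leftForm, reflect_rightForm]

theorem Regular.reflect (hL : L.Regular) : L.reflect.Regular where
  add_h1 := by simpa [SystemPencil.reflect, sub_eq_add_neg] using hL.sub_h1
  sub_h1 := by simpa [SystemPencil.reflect] using hL.add_h1
  add_H1 := by simpa [SystemPencil.reflect, sub_eq_add_neg] using hL.sub_H1
  sub_H1 := by simpa [SystemPencil.reflect] using hL.add_H1

/-- `L` and `L'` have the same Weyl function. -/
def SameWeyl (L L' : SystemPencil E) (b : ℝ) : Prop :=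
  ∀ ρ, (∃ M, L.IsWeyl ρ b M) → (∃ M, L'.IsWeyl ρ b M) → ∃ M, L.IsWeyl ρ b M ∧ L'.IsWeyl ρ b M

theorem SameWeyl.reflect (h : SameWeyl L L' b) : SameWeyl L.reflect L'.reflect b := by
  simp only [SameWeyl, reflect_isWeyl]
  exact fun ρ => h (-ρ)

theorem SameWeyl.exists_common [FiniteDimensional ℂ E] (h : SameWeyl L L' b) (hL : L.Regular)
    (hL' : L'.Regular) (hb : 0 < b) :
    ∃ R, ∀ ρ : ℂ, R ≤ ‖ρ‖ → ‖ρ‖ ≤ 2 * ρ.im → ∃ M, L.IsWeyl ρ b M ∧ L'.IsWeyl ρ b M := by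
  obtain ⟨R, hR⟩ := exists_isWeyl hL hb
  obtain ⟨R', hR'⟩ := exists_isWeyl hL' hb
  exact ⟨max R R', fun ρ hρ him => h ρ (hR ρ ((le_max_left _ _).trans hρ) him)
    (hR' ρ ((le_max_right _ _).trans hρ) him)⟩

theorem SameWeyl.exists_norm_fst_le [FiniteDimensional ℂ E] (h : SameWeyl L L' b) (hL : L.Regular)
    (hL' : L'.Regular) {x : ℝ} (hx : x ∈ Ioo 0 b) :
    ∃ C R, ∀ ρ : ℂ, R ≤ ‖ρ‖ → |ρ.re| = |ρ.im| →
      ∀ w w', L.IsSol ρ b w → L'.IsSol ρ b w' → (w 0).1 = (w' 0).1 →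
      L.leftForm ρ (w 0) = L'.leftForm ρ (w' 0) → (w' x).1 = 0 →
      ‖(w x).1‖ ≤ C / ‖ρ‖ * ‖(w' x).2‖ := by
  have hb : 0 < b := hx.1.trans hx.2
  obtain ⟨R₁, hR₁⟩ := h.exists_common hL hL' hb
  obtain ⟨R₂, hR₂⟩ := h.reflect.exists_common hL.reflect hL'.reflect hb
  obtain ⟨C₃, R₃, h₃⟩ := SystemPencil.exists_norm_fst_le hL hL' hx
  obtain ⟨C₄, R₄, h₄⟩ := SystemPencil.exists_norm_fst_le hL.reflect hL'.reflect hx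
  simp only [reflect_isWeyl, reflect_isSol, reflect_leftForm] at hR₂ h₄
  refine ⟨max C₃ C₄, max (max R₁ R₂) (max R₃ R₄), fun ρ hρ hre w w' hw hw' h0 hl hz => ?_⟩
  simp only [max_le_iff] at hρ
  obtain ⟨⟨r1, r2⟩, r3, r4⟩ := hρ
  have hn := Complex.norm_le_abs_re_add_abs_im ρ
  rw [hre] at hn
  rcases le_total 0 ρ.im with hi | hi
  · rw [abs_of_nonneg hi] at hn
    have him : ‖ρ‖ ≤ 2 * ρ.im := by linarith
    obtain ⟨M, hM, hM'⟩ := hR₁ ρ r1 him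
    refine (h₃ ρ r3 him M hM hM' w w' hw hw' h0 hl hz).trans ?_
    gcongr
    exact le_max_left _ _
  · rw [abs_of_nonpos hi] at hn
    have him : ‖-ρ‖ ≤ 2 * (-ρ).im := by rw [norm_neg, Complex.neg_im]; linarith
    rw [← norm_neg] at r2 r4
    obtain ⟨M, hM, hM'⟩ := hR₂ (-ρ) r2 him
    have := h₄ (-ρ) r4 him M hM hM' w w'
    rw [neg_neg, norm_neg] at this
    refine (this hw hw' h0 hl hz).trans ?_
    gcongr
    exact le_max_right _ _

/-- The change of initial data that preserves the first component and intertwines the left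
boundary forms of `L'` and `L`. -/
noncomputable def initialChange (L L' : SystemPencil E) (ρ : ℂ) : (E × E) →L[ℂ] (E × E) :=
  blockCLM 1 0 (ρ • (Complex.I • (L'.h1 - L.h1)) + (L'.h0 - L.h0)) 1

theorem leftForm_initialChange (L L' : SystemPencil E) (ρ : ℂ) (w : E × E) :
    L.leftForm ρ (initialChange L L' ρ w) = L'.leftForm ρ w := by
  simp only [leftForm, initialChange, blockCLM_apply, add_apply, smul_apply, sub_apply,
    one_apply_eq_self, zero_apply, add_zero]
  module

theorem differentiable_initialChange (L L' : SystemPencil E) :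
    Differentiable ℂ (initialChange L L') := by
  have : initialChange L L' = fun ρ => blockCLM 1 0 (L'.h0 - L.h0) 1
      + ρ • blockCLM 0 0 (Complex.I • (L'.h1 - L.h1)) 0
      + ρ ^ 2 • (0 : (E × E) →L[ℂ] (E × E)) := by
    ext ρ w
    all_goals simp [initialChange]
    all_goals module
  rw [this]
  exact differentiable_quadratic (G := (E × E) →L[ℂ] (E × E)) _ _ _

theorem exists_norm_initialChange_le (L L' : SystemPencil E) :
    ∃ A ≥ 0, ∀ ρ : ℂ, ‖initialChange L L' ρ‖ ≤ A * Real.exp ‖ρ‖ := by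
  set a := ‖Complex.I • (L'.h1 - L.h1)‖ with ha
  set c := ‖L'.h0 - L.h0‖ with hc
  refine ⟨2 + a + c, by positivity, fun ρ => (norm_blockCLM_le _ _ _ _).trans ?_⟩
  have h1 : ‖(1 : E →L[ℂ] E)‖ ≤ 1 := ContinuousLinearMap.norm_id_le
  have h2 := norm_add_le (ρ • (Complex.I • (L'.h1 - L.h1))) (L'.h0 - L.h0)
  rw [norm_smul, ← ha, ← hc] at h2
  have h3 := Real.add_one_le_exp ‖ρ‖
  have h4 : 1 ≤ Real.exp ‖ρ‖ := Real.one_le_exp (norm_nonneg _)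
  have h5 : ‖ρ‖ * a ≤ Real.exp ‖ρ‖ * a := by gcongr; linarith
  have h6 : c * 1 ≤ c * Real.exp ‖ρ‖ := by gcongr
  rw [norm_zero]
  linarith

/-- The upper right block of the transformation between the two fundamental systems vanishes. -/
theorem SameWeyl.fst_transform_eq_zero [FiniteDimensional ℂ E] (h : SameWeyl L L' b)
    (hL : L.Regular) (hL' : L'.Regular) {W V : ℂ → ℝ → (E × E) →L[ℂ] (E × E)}
    (hW : ∀ ρ, IsPropagator (L.gen ρ) b (W ρ)) (hV : ∀ ρ, IsCopropagator (L'.gen ρ) b (V ρ))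
    (hWd : ∀ x ∈ Icc 0 b, Differentiable ℂ fun ρ => W ρ x)
    (hVd : ∀ x ∈ Icc 0 b, Differentiable ℂ fun ρ => V ρ x) {x : ℝ} (hx : x ∈ Ioo 0 b) (ρ : ℂ)
    (v : E) : (W ρ x (initialChange L L' ρ (V ρ x (0, v)))).1 = 0 := by
  have : CompleteSpace E := FiniteDimensional.complete ℂ E
  have hxI : x ∈ Icc 0 b := Ioo_subset_Icc_self hx
  obtain ⟨W', -, hW', -⟩ := L'.exists_entire_fundamental (hx.1.trans hx.2).le
  obtain ⟨C, R, hCR⟩ := h.exists_norm_fst_le hL hL' hx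
  obtain ⟨K, hK⟩ := L.exists_norm_propagator_le b
  obtain ⟨K', hK'⟩ := L'.exists_norm_propagator_le b
  obtain ⟨A, hA, hA'⟩ := exists_norm_initialChange_le L L'
  refine eq_zero_of_exponential_type_of_diagonal_decay
    (F := fun ρ => (W ρ x (initialChange L L' ρ (V ρ x (0, v)))).1) (A := A * ‖v‖)
    (B := K + 1 + K') (C := C * ‖v‖) (R := R) ?_ (fun ρ hρ => ?_) (fun ρ hρ hre => ?_) ρ
  · exact (((hWd x hxI).clm_apply ((differentiable_initialChange L L').clm_apply
      ((hVd x hxI).clm_apply (differentiable_const _)))).fst)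
  · have h1 := (hK ρ hρ x hxI).1 _ (hW ρ)
    have h2 := (hK' ρ hρ x hxI).2 _ (hV ρ)
    have hv : ‖((0, v) : E × E)‖ ≤ ‖v‖ := by simp [Prod.norm_def]
    calc _ ≤ ‖W ρ x (initialChange L L' ρ (V ρ x (0, v)))‖ := norm_fst_le _
      _ ≤ Real.exp (K * ‖ρ‖) * (A * Real.exp ‖ρ‖ * (Real.exp (K' * ‖ρ‖) * ‖v‖)) := by
        refine (W ρ x).le_of_opNorm_le_of_le h1 ?_
        refine (initialChange L L' ρ).le_of_opNorm_le_of_le (hA' ρ) ?_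
        exact (V ρ x).le_of_opNorm_le_of_le h2 hv
      _ = _ := by
        rw [show (K + 1 + K') * ‖ρ‖ = K * ‖ρ‖ + ‖ρ‖ + K' * ‖ρ‖ by ring, Real.exp_add, Real.exp_add]
        ring
  · have hid : W' ρ x (V ρ x (0, v)) = (0, v) := by
      have := (hW' ρ).mul_copropagator (hV ρ) hxI
      exact congrArg (fun T : (E × E) →L[ℂ] (E × E) => T (0, v)) this
    have := hCR ρ hρ hre _ _ (isSol_apply (hW ρ) (initialChange L L' ρ (V ρ x (0, v))))
      (isSol_apply (hW' ρ) (V ρ x (0, v)))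
      (by simp [(hW ρ).zero, (hW' ρ).zero, initialChange])
      (by simp [(hW ρ).zero, (hW' ρ).zero, leftForm_initialChange]) (by rw [hid])
    rw [hid] at this
    rwa [mul_div_right_comm]

end SystemPencil

namespace SystemPencil

variable {E : Type*} [NormedAddCommGroup E] [InnerProductSpace ℂ E]
variable {L L' : SystemPencil E} {ρ : ℂ} {b : ℝ}

/-- If the upper right block of the transformation `T = W N V'` vanishes, then `T` has diagonal
blocks `1`, and its lower left block is `s - s'`. -/
theorem transform_apply {W V : ℝ → (E × E) →L[ℂ] (E × E)}
    (hW : IsPropagator (L.gen ρ) b W) (hV : IsCopropagator (L'.gen ρ) b V) (hb : 0 < b)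
    (h12 : ∀ x ∈ Icc 0 b, ∀ v, (W x (initialChange L L' ρ (V x (0, v)))).1 = 0) (w : E × E)
    {x : ℝ} (hx : x ∈ Icc 0 b) :
    W x (initialChange L L' ρ (V x w)) = (w.1, w.2 + (L.s x w.1 - L'.s x w.1)) := by
  set T : ℝ → (E × E) →L[ℂ] (E × E) := fun x => W x * initialChange L L' ρ * V x with hT
  have hTd : ∀ w₀, ∀ x ∈ Icc 0 b, HasDerivAt (fun x => T x w₀)
      (L.gen ρ x (T x w₀) - T x (L'.gen ρ x w₀)) x := fun w₀ x hx =>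
    hasDerivAt_propagator_mul_copropagator hW hV _ w₀ hx
  have hTd1 : ∀ w₀, ∀ x ∈ Icc 0 b, HasDerivWithinAt (fun x => (T x w₀).1)
      (L.gen ρ x (T x w₀) - T x (L'.gen ρ x w₀)).1 (Icc 0 b) x := fun w₀ x hx =>
    (hasDerivAt_prod_fst (hTd w₀ x hx)).hasDerivWithinAt
  have hTd2 : ∀ w₀, ∀ x ∈ Icc 0 b, HasDerivWithinAt (fun x => (T x w₀).2)
      (L.gen ρ x (T x w₀) - T x (L'.gen ρ x w₀)).2 (Icc 0 b) x := fun w₀ x hx =>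
    (hasDerivAt_prod_snd (hTd w₀ x hx)).hasDerivWithinAt
  have hu := uniqueDiffOn_Icc hb
  have h0 : ∀ x ∈ Icc 0 b, ∀ v, (T x (0, v)).1 = 0 := h12
  have split : ∀ x (y z : E), T x (y, z) = T x (y, 0) + T x (0, z) := fun x y z => by
    rw [← map_add]; simp
  -- the diagonal blocks agree
  have hdiag : ∀ x ∈ Icc 0 b, ∀ v, (T x (0, v)).2 = (T x (v, 0)).1 := fun x hx v => by
    have h1 := hTd1 (0, v) x hx
    have h2 : HasDerivWithinAt (fun x => (T x (0, v)).1) 0 (Icc 0 b) x :=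
      (hasDerivWithinAt_const x (Icc 0 b) (0 : E)).congr (fun y hy => h0 y hy v) (h0 x hx v)
    have h3 := (hu x hx).eq_deriv _ h1 h2
    have h4 : T x (v, L'.s x v) = T x (v, 0) + T x (0, L'.s x v) := split _ _ _
    simp only [gen, blockCLM_apply, Prod.fst_sub, h0 x hx, map_zero, zero_add, one_apply_eq_self,
      h4, Prod.fst_add, add_zero] at h3
    exact sub_eq_zero.1 h3
  have hmain : ∀ x ∈ Icc 0 b, ∀ v,
      (T x (v, 0)).2 = L.s x (T x (v, 0)).1 - (T x (L'.s x v, 0)).1 ∧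
      HasDerivWithinAt (fun x => (T x (v, 0)).1) 0 (Icc 0 b) x := fun x hx v => by
    have h1 := hTd1 (v, 0) x hx
    have h2 := (hTd2 (0, v) x hx).congr (fun y hy => (hdiag y hy v).symm) (hdiag x hx v).symm
    have h3 := (hu x hx).eq_deriv _ h1 h2
    have e1 : (L.gen ρ x (T x (v, 0)) - T x (L'.gen ρ x (v, 0))).1 =
        -L.s x (T x (v, 0)).1 + (T x (v, 0)).2 + (T x (L'.s x v, 0)).1 := by
      simp only [gen, blockCLM_apply, Prod.fst_sub, map_zero, add_zero, neg_apply,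
        one_apply_eq_self]
      rw [split x (-L'.s x v), Prod.fst_add, h0 x hx, add_zero,
        show ((-L'.s x v, 0) : E × E) = -(L'.s x v, 0) by simp, map_neg, Prod.fst_neg]
      abel
    have e2 : (L.gen ρ x (T x (0, v)) - T x (L'.gen ρ x (0, v))).2 =
        L.s x (T x (v, 0)).1 - (T x (v, 0)).2 - (T x (L'.s x v, 0)).1 := by
      simp only [gen, blockCLM_apply, Prod.snd_sub, map_zero, h0 x hx, zero_add, hdiag x hx,
        one_apply_eq_self]
      rw [split x v (L'.s x v), Prod.snd_add, hdiag x hx]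
      abel
    have e3 : (2 : ℂ) • ((T x (v, 0)).2 - (L.s x (T x (v, 0)).1 - (T x (L'.s x v, 0)).1)) = 0 := by
      rw [e1, e2] at h3
      refine Eq.trans ?_ (sub_eq_zero.2 h3)
      module
    have e4 := sub_eq_zero.1 ((smul_eq_zero.1 e3).resolve_left two_ne_zero)
    refine ⟨e4, h1.congr_deriv ?_⟩
    rw [e1, e4]
    abel
  have h11 : ∀ x ∈ Icc 0 b, ∀ v, (T x (v, 0)).1 = v := fun x hx v => by
    rw [eq_of_hasDerivWithinAt_zero (fun x hx => (hmain x hx v).2) hx]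
    simp [hT, hW.zero, hV.zero, initialChange]
  change T x (w.1, w.2) = _
  rw [split]
  refine Prod.ext ?_ ?_
  · rw [Prod.fst_add, h0 x hx, h11 x hx, add_zero]
  · rw [Prod.snd_add, hdiag x hx, (hmain x hx w.1).1, h11 x hx, h11 x hx, h11 x hx, add_comm]

/-- The lower left block of the transformation satisfies a differential equation. -/
theorem hasDerivWithinAt_s_sub {W V : ℝ → (E × E) →L[ℂ] (E × E)}
    (hW : IsPropagator (L.gen ρ) b W) (hV : IsCopropagator (L'.gen ρ) b V) (hb : 0 < b)
    (h12 : ∀ x ∈ Icc 0 b, ∀ v, (W x (initialChange L L' ρ (V x (0, v)))).1 = 0) (v : E) {x : ℝ}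
    (hx : x ∈ Icc 0 b) :
    HasDerivWithinAt (fun x => L.s x v - L'.s x v)
      (-((2 * Complex.I * ρ) • (L.q x v - L'.q x v))) (Icc 0 b) x := by
  have hT := fun w {x} (hx : x ∈ Icc 0 b) => transform_apply hW hV hb h12 w hx
  have h1 := (hasDerivAt_prod_snd (hasDerivAt_propagator_mul_copropagator hW hV
    (initialChange L L' ρ) (v, 0) hx)).hasDerivWithinAt (s := Icc 0 b)
  have heq : ∀ y ∈ Icc 0 b, L.s y v - L'.s y v
      = (W y (initialChange L L' ρ (V y (v, 0)))).2 := fun y hy => by simp [hT _ hy]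
  refine (h1.congr heq (heq x hx)).congr_deriv ?_
  change (_ - _ : E × E).2 = _
  rw [hT _ hx, hT _ hx]
  simp only [gen, blockCLM_apply, Prod.snd_sub, map_zero, zero_add, add_zero, neg_apply, add_apply,
    smul_apply, one_apply_eq_self, mul_apply_eq_comp, map_sub, map_neg]
  module

/-- Two pencils with the same Weyl function have the same coefficients. -/
theorem SameWeyl.eq [FiniteDimensional ℂ E] (h : SameWeyl L L' b) (hL : L.Regular)
    (hL' : L'.Regular) (hb : 0 < b) (hs : L.s 0 = L'.s 0) :
    EqOn L.q L'.q (Icc 0 b) ∧ EqOn L.s L'.s (Icc 0 b) ∧ L.h1 = L'.h1 ∧ L.h0 = L'.h0 ∧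
      L.H1 = L'.H1 ∧ L.H0 = L'.H0 := by
  have : CompleteSpace E := FiniteDimensional.complete ℂ E
  obtain ⟨W, V, hW, hV, hWd, hVd⟩ := L.exists_entire_fundamental hb.le
  obtain ⟨W', V', hW', hV', hWd', hVd'⟩ := L'.exists_entire_fundamental hb.le
  have h0b : (0 : ℝ) ∈ Icc 0 b := ⟨le_rfl, hb.le⟩
  have hbb : b ∈ Icc 0 b := ⟨hb.le, le_rfl⟩
  have h12 : ∀ ρ, ∀ x ∈ Icc 0 b, ∀ v, (W ρ x (initialChange L L' ρ (V' ρ x (0, v)))).1 = 0 := by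
    intro ρ x hx v
    have hc : ContinuousOn (fun x => (W ρ x (initialChange L L' ρ (V' ρ x (0, v)))).1) (Icc 0 b) :=
      fun x hx => (hasDerivAt_propagator_mul_copropagator (hW ρ) (hV' ρ) _ _
        hx).continuousAt.fst.continuousWithinAt
    exact EqOn.of_subset_closure (s := Ioo 0 b) (t := Icc 0 b) (g := fun _ => (0 : E))
      (fun x hx => h.fst_transform_eq_zero hL hL' hW hV' hWd hVd' hx ρ v) hc continuousOn_const
      Ioo_subset_Icc_self (closure_Ioo hb.ne).ge hx
  have hds := fun ρ v {x} (hx : x ∈ Icc 0 b) =>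
    hasDerivWithinAt_s_sub (hW ρ) (hV' ρ) hb (h12 ρ) v hx
  have hseq : EqOn L.s L'.s (Icc 0 b) := fun x hx => by
    refine ContinuousLinearMap.ext fun v => ?_
    have := eq_of_hasDerivWithinAt_zero (f := fun x => L.s x v - L'.s x v)
      (fun x hx => by simpa using hds 0 v hx) hx
    rw [hs, sub_self] at this
    exact sub_eq_zero.1 this
  have hqeq : EqOn L.q L'.q (Icc 0 b) := fun x hx => by
    refine ContinuousLinearMap.ext fun v => ?_
    have := (uniqueDiffOn_Icc hb x hx).eq_deriv _ (hds 0 v hx) (hds 1 v hx)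
    have : (2 * Complex.I) • (L.q x v - L'.q x v) = 0 := by simpa using this.symm
    exact sub_eq_zero.1 ((smul_eq_zero.1 this).resolve_left (by simp))
  have affine : ∀ {X₁ X₀ : E →L[ℂ] E} {ρ₁ ρ₂ : ℂ}, ρ₁ ≠ ρ₂ → (Complex.I * ρ₁) • X₁ + X₀ = 0 →
      (Complex.I * ρ₂) • X₁ + X₀ = 0 → X₁ = 0 ∧ X₀ = 0 := fun {X₁ X₀ ρ₁ ρ₂} hne e₁ e₂ => by
    have h1 : (Complex.I * (ρ₁ - ρ₂)) • X₁ = 0 := by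
      rw [mul_sub, sub_smul, ← add_sub_add_right_eq_sub _ _ X₀, e₁, e₂, sub_self]
    have h2 : X₁ = 0 := (smul_eq_zero.1 h1).resolve_left
      (mul_ne_zero Complex.I_ne_zero (sub_ne_zero.2 hne))
    exact ⟨h2, by simpa [h2] using e₁⟩
  have hh : ∀ ρ : ℂ, (Complex.I * ρ) • (L'.h1 - L.h1) + (L'.h0 - L.h0) = 0 := fun ρ => by
    refine ContinuousLinearMap.ext fun v => ?_
    have := congrArg Prod.snd (transform_apply (hW ρ) (hV' ρ) hb (h12 ρ) (v, 0) h0b)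
    rw [(hW ρ).zero, (hV' ρ).zero, hs] at this
    simpa [initialChange, smul_smul, mul_comm ρ] using this
  obtain ⟨hh1, hh0⟩ := affine (zero_ne_one (α := ℂ)) (hh 0) (hh 1)
  have hh1' := (sub_eq_zero.1 hh1).symm
  have hh0' := (sub_eq_zero.1 hh0).symm
  obtain ⟨R, hR⟩ := h.exists_common hL hL' hb
  have hH : ∀ ρ : ℂ, R ≤ ‖ρ‖ → ‖ρ‖ ≤ 2 * ρ.im →
      (Complex.I * ρ) • (L.H1 - L'.H1) + (L.H0 - L'.H0) = 0 := fun ρ hρ him => by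
    obtain ⟨M, hM, hM'⟩ := hR ρ hρ him
    set n : E →L[ℂ] E := (Complex.I * ρ) • L.h1 + L.h0 with hn
    set J : E →L[ℂ] E × E := W ρ b ∘L M.prod (ContinuousLinearMap.id ℂ E - n ∘L M) with hJ
    have hWV := (hW ρ).mul_copropagator (hV ρ) hbb
    have hVW := (hW ρ).copropagator_mul (hV ρ) hbb
    have hprop : ∀ w : ℝ → E × E, L.IsSol ρ b w → w b = W ρ b (w 0) := fun w hw => by
      rw [← (hV ρ).apply_eq (fun x hx => (hw x hx).hasDerivWithinAt) hbb]
      exact (congrArg (fun T : (E × E) →L[ℂ] (E × E) => T (w b)) hWV).symm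
    have hform : ∀ w : E × E, ∀ d, w.1 = M d → w.2 + n w.1 = d → w = (M d, d - n (M d)) :=
      fun w d h1 h2 => Prod.ext h1 (by rw [h1] at h2; exact eq_sub_of_add_eq h2)
    have hJr : ∀ d, L.rightForm ρ (J d) = 0 := fun d => by
      obtain ⟨w, hw, w1, w2, w3⟩ := hM d
      rwa [hprop w hw, hform _ _ w1 w2] at w3
    have hJr' : ∀ d, L'.rightForm ρ (J d) = 0 := fun d => by
      obtain ⟨w, hw, w1, w2, w3⟩ := hM' d
      have hw' : L.IsSol ρ b w := fun x hx => by
        refine (hw x hx).congr_deriv ?_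
        rw [gen, gen, hseq hx, hqeq hx]
      rw [leftForm, ← hh1', ← hh0'] at w2
      rwa [hprop w hw', hform _ _ w1 w2] at w3
    set Y : E →ₗ[ℂ] E := ((ContinuousLinearMap.fst ℂ E E ∘L J : E →L[ℂ] E) : E →ₗ[ℂ] E) with hY
    have hinj : Function.Injective Y := (injective_iff_map_eq_zero _).2 fun d hd => by
      have hd1 : (J d).1 = 0 := hd
      have hd2 : (J d).2 = 0 := by simpa [rightForm, hd1] using hJr d
      have hd3 : W ρ b (M d, d - n (M d)) = 0 := Prod.ext hd1 hd2
      have hd4 : ((M d, d - n (M d)) : E × E) = 0 := by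
        rw [← map_zero (V ρ b), ← hd3]
        exact (congrArg (fun T : (E × E) →L[ℂ] (E × E) => T (M d, d - n (M d))) hVW).symm
      have hd5 : M d = 0 := congrArg Prod.fst hd4
      simpa [hd5] using congrArg Prod.snd hd4
    refine ContinuousLinearMap.ext fun y => ?_
    obtain ⟨d, rfl⟩ := LinearMap.surjective_of_injective hinj y
    have h1 := hJr d
    have h2 := hJr' d
    rw [rightForm] at h1 h2
    have h3 := (sub_eq_zero.2 (h1.trans h2.symm))
    change ((Complex.I * ρ) • (L.H1 - L'.H1) + (L.H0 - L'.H0)) (J d).1 = 0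
    rw [← h3]
    simp only [add_apply, smul_apply, sub_apply]
    module
  have hpos : (0 : ℝ) < |R| + 1 := by positivity
  have hnorm : ∀ t : ℝ, 0 < t → ‖(t : ℂ) * Complex.I‖ = t := fun t ht => by
    simp [abs_of_pos ht]
  have hray : ∀ t : ℝ, |R| + 1 ≤ t → (Complex.I * (t * Complex.I)) • (L.H1 - L'.H1)
      + (L.H0 - L'.H0) = 0 := fun t ht => by
    have ht0 : 0 < t := by linarith
    refine hH _ ?_ ?_
    · rw [hnorm t ht0]; linarith [le_abs_self R]
    · rw [hnorm t ht0]; simp; linarith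
  obtain ⟨hH1, hH0⟩ := affine (fun hc => by
    have := congrArg norm hc
    rw [hnorm _ hpos, hnorm _ (by linarith : 0 < |R| + 2)] at this
    linarith) (hray (|R| + 1) le_rfl) (hray (|R| + 2) (by linarith))
  exact ⟨hqeq, hseq, hh1', hh0', sub_eq_zero.1 hH1, sub_eq_zero.1 hH0⟩

end SystemPencil

section AbsolutelyContinuous

variable {a b : ℝ}

theorem AbsolutelyContinuousOnInterval.finset_sum {F ι : Type*} [NormedAddCommGroup F]
    (s : Finset ι) {f : ι → ℝ → F} (hf : ∀ i, AbsolutelyContinuousOnInterval (f i) a b) :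
    AbsolutelyContinuousOnInterval (fun x => ∑ i ∈ s, f i x) a b := by
  classical
  induction s using Finset.induction_on with
  | empty =>
    exact ((LipschitzWith.const (0 : F)).lipschitzOnWith (s := uIcc a b)).absolutelyContinuousOnInterval
  | insert i s hi ih =>
    simp only [Finset.sum_insert hi]
    exact (hf i).add ih

theorem absolutelyContinuousOnInterval_of_hasDerivWithinAt {F : Type*} [NormedAddCommGroup F]
    [NormedSpace ℝ F] (hab : a ≤ b) {f f' : ℝ → F}
    (hf : ∀ x ∈ Icc a b, HasDerivWithinAt f (f' x) (Icc a b) x) (hc : ContinuousOn f' (Icc a b)) :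
    AbsolutelyContinuousOnInterval f a b := by
  obtain ⟨C, hC⟩ := isCompact_Icc.exists_bound_of_continuousOn hc
  refine LipschitzOnWith.absolutelyContinuousOnInterval (K := C.toNNReal) ?_
  rw [uIcc_of_le hab]
  refine (convex_Icc a b).lipschitzOnWith_of_nnnorm_hasDerivWithin_le hf fun x hx => ?_
  exact NNReal.le_toNNReal_of_coe_le (hC x hx)

/-- An absolutely continuous function whose almost everywhere derivative is continuous is
continuously differentiable. -/
theorem AbsolutelyContinuousOnInterval.hasDerivWithinAt_of_ae {F : Type*} [NormedAddCommGroup F]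
    [NormedSpace ℝ F] [CompleteSpace F] (hab : a ≤ b) {f f' : ℝ → F}
    (hf : AbsolutelyContinuousOnInterval f a b) (hc : ContinuousOn f' (Icc a b))
    (hd : ∀ᵐ x ∂volume.restrict (Icc a b), HasDerivAt f (f' x) x) {x : ℝ} (hx : x ∈ Icc a b) :
    HasDerivWithinAt f (f' x) (Icc a b) x := by
  set g : ℝ → F := IccExtend hab ((Icc a b).domRestrict f') with hg
  have hgc : Continuous g := (continuousOn_iff_continuous_domRestrict.1 hc).Icc_extend'
  have hge : ∀ x ∈ Icc a b, g x = f' x := fun x hx => by rw [hg, IccExtend_of_mem _ _ hx]; rfl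
  set P : ℝ → F := fun x => ∫ t in a..x, g t with hP
  have hPd : ∀ x, HasDerivAt P (g x) x := fun x => hgc.integral_hasStrictDerivAt a x |>.hasDerivAt
  have hPac : AbsolutelyContinuousOnInterval P a b :=
    absolutelyContinuousOnInterval_of_hasDerivWithinAt hab
      (fun x _ => (hPd x).hasDerivWithinAt) hgc.continuousOn
  rw [ae_restrict_iff' measurableSet_Icc] at hd
  obtain ⟨C, hC⟩ := (hf.sub hPac).const_of_ae_hasDerivAt_zero (by
    filter_upwards [hd] with x hx hxm
    rw [uIcc_of_le hab] at hxm
    refine ((hx hxm).sub (hPd x)).congr_deriv ?_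
    rw [hge x hxm, sub_self])
  rw [uIcc_of_le hab] at hC
  have hfe : ∀ x ∈ Icc a b, f x = P x + C := fun x hx => by
    rw [← hC x hx, Pi.sub_apply, add_sub_cancel]
  rw [← hge x hx]
  exact ((hPd x).add_const C).hasDerivWithinAt.congr hfe (hfe x hx)

theorem AbsolutelyContinuousOnInterval.continuous_comp_projIcc {F : Type*} [NormedAddCommGroup F]
    {f : ℝ → F} (hab : a ≤ b) (hf : AbsolutelyContinuousOnInterval f a b) :
    Continuous fun x => f (projIcc a b hab x) := by
  have := hf.continuousOn
  rw [uIcc_of_le hab] at this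
  exact this.comp_continuous (continuous_subtype_val.comp continuous_projIcc)
    fun x => (projIcc a b hab x).2

theorem absolutelyContinuousOnInterval_integral_complex {f : ℝ → ℂ}
    (hf : IntervalIntegrable f volume a b) :
    AbsolutelyContinuousOnInterval (fun x => ∫ t in a..x, f t) a b := by
  have hre : IntervalIntegrable (fun t => (f t).re) volume a b := ⟨hf.1.re, hf.2.re⟩
  have him : IntervalIntegrable (fun t => (f t).im) volume a b := ⟨hf.1.im, hf.2.im⟩
  have h := ((hre.absolutelyContinuousOnInterval_intervalIntegral left_mem_uIcc).smul
    ((LipschitzWith.const (1 : ℂ)).lipschitzOnWith (s := uIcc a b)).absolutelyContinuousOnInterval).add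
    ((him.absolutelyContinuousOnInterval_intervalIntegral left_mem_uIcc).smul
    ((LipschitzWith.const Complex.I).lipschitzOnWith (s := uIcc a b)).absolutelyContinuousOnInterval)
  have key : ∀ x ∈ uIcc a b, ∫ t in a..x, f t =
      (∫ t in a..x, (f t).re) • (1 : ℂ) + (∫ t in a..x, (f t).im) • Complex.I := fun x hx => by
    have hfx : IntervalIntegrable f volume a x := hf.mono_set (uIcc_subset_uIcc_left hx)
    have h1 : ∫ t in a..x, (f t).re = (∫ t in a..x, f t).re :=
      Complex.reCLM.intervalIntegral_comp_comm hfx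
    have h2 : ∫ t in a..x, (f t).im = (∫ t in a..x, f t).im :=
      Complex.imCLM.intervalIntegral_comp_comm hfx
    rw [h1, h2]
    simp [Complex.re_add_im]
  rw [absolutelyContinuousOnInterval_iff] at h ⊢
  intro ε hε
  obtain ⟨δ, hδ, H⟩ := h ε hε
  refine ⟨δ, hδ, fun E hE hs => ?_⟩
  refine lt_of_eq_of_lt (Finset.sum_congr rfl fun i hi => ?_) (H E hE hs)
  have := hE.1 i hi
  rw [key _ this.1, key _ this.2]
  rfl

end AbsolutelyContinuous

section EuclideanOperators

variable {m : ℕ}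

theorem continuous_toEuclideanCLM :
    Continuous (Matrix.toEuclideanCLM (𝕜 := ℂ) (n := Fin m)) :=
  LinearMap.continuous_of_finiteDimensional
    (Matrix.toEuclideanCLM (𝕜 := ℂ) (n := Fin m)).toAlgEquiv.toLinearMap

theorem toEuclideanCLM_apply_apply (A : Matrix (Fin m) (Fin m) ℂ) (v : EuclideanSpace ℂ (Fin m))
    (j : Fin m) : Matrix.toEuclideanCLM (𝕜 := ℂ) A v j = ∑ k, A j k * v k := by
  rw [Matrix.ofLp_toEuclideanCLM]
  rfl

theorem hasDerivWithinAt_toEuclideanCLM_apply {A : ℝ → Matrix (Fin m) (Fin m) ℂ}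
    {A' : Matrix (Fin m) (Fin m) ℂ} {s : Set ℝ} {x : ℝ}
    (h : ∀ j k, HasDerivWithinAt (fun t => A t j k) (A' j k) s x)
    (d : EuclideanSpace ℂ (Fin m)) :
    HasDerivWithinAt (fun t => Matrix.toEuclideanCLM (𝕜 := ℂ) (A t) d)
      (Matrix.toEuclideanCLM (𝕜 := ℂ) A' d) s x := by
  have h1 : HasDerivWithinAt (fun t => (A t).mulVec d.ofLp) (A'.mulVec d.ofLp) s x :=
    hasDerivWithinAt_pi.2 fun j =>
      HasDerivWithinAt.fun_sum (u := Finset.univ) fun k _ => (h j k).mul_const (d.ofLp k)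
  exact ((PiLp.continuousLinearEquiv 2 ℝ fun _ : Fin m => ℂ).symm :
    (Fin m → ℂ) →L[ℝ] PiLp 2 fun _ : Fin m => ℂ).hasFDerivAt.comp_hasDerivWithinAt x h1

theorem hasDerivAt_euclidean_apply {y : ℝ → EuclideanSpace ℂ (Fin m)}
    {y' : EuclideanSpace ℂ (Fin m)} {x : ℝ} (h : HasDerivAt y y' x) (j : Fin m) :
    HasDerivAt (fun t => y t j) (y' j) x :=
  ((PiLp.proj 2 (𝕜 := ℝ) (fun _ : Fin m => ℂ) j).hasFDerivAt).comp_hasDerivAt x h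

theorem isUnit_toEuclideanCLM {A : Matrix (Fin m) (Fin m) ℂ} (hA : A.det ≠ 0) :
    IsUnit (Matrix.toEuclideanCLM (𝕜 := ℂ) A) :=
  ((Matrix.isUnit_iff_isUnit_det A).2 hA.isUnit).map (Matrix.toEuclideanCLM (𝕜 := ℂ) (n := Fin m))

end EuclideanOperators

namespace QuadraticPencil

variable {m : ℕ} {L L' : QuadraticPencil m} {ρ : ℂ}

/-- The primitive of `Q₀` that vanishes at `0`. -/
noncomputable def primitive (L : QuadraticPencil m) (x : ℝ) : Matrix (Fin m) (Fin m) ℂ :=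
  Matrix.of fun j k => ∫ t in (0 : ℝ)..x, L.Q0 t j k

theorem intervalIntegrable_Q0 (L : QuadraticPencil m) (j k : Fin m) :
    IntervalIntegrable (fun x => L.Q0 x j k) volume 0 Real.pi :=
  (intervalIntegrable_iff_integrableOn_Icc_of_le Real.pi_nonneg).2 (L.integrable_Q0 j k)

theorem absolutelyContinuous_primitive (L : QuadraticPencil m) (j k : Fin m) :
    AbsolutelyContinuousOnInterval (fun x => L.primitive x j k) 0 Real.pi :=
  absolutelyContinuousOnInterval_integral_complex (L.intervalIntegrable_Q0 j k)

theorem ae_hasDerivAt_primitive (L : QuadraticPencil m) :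
    ∀ᵐ x ∂(volume.restrict (Icc 0 Real.pi)), ∀ j k,
      HasDerivAt (fun t => L.primitive t j k) (L.Q0 x j k) x := by
  rw [ae_all_iff]
  intro j
  rw [ae_all_iff]
  intro k
  rw [ae_restrict_iff' measurableSet_Icc]
  filter_upwards [(L.intervalIntegrable_Q0 j k).ae_hasDerivAt_integral] with x hx hxm
  rw [← uIcc_of_le Real.pi_nonneg] at hxm
  exact hx hxm 0 left_mem_uIcc

@[simp]
theorem primitive_zero (L : QuadraticPencil m) : L.primitive 0 = 0 := by
  ext j k
  simp [primitive]

/-- The first-order form of a quadratic pencil, with unknowns `Y` and `Y' + σ Y`, where `σ` is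
the primitive of `Q₀`. The coefficients are continuous, being extended by constants. -/
noncomputable def toSystem (L : QuadraticPencil m) : SystemPencil (EuclideanSpace ℂ (Fin m)) where
  q x := Matrix.toEuclideanCLM (𝕜 := ℂ) (L.Q1 (projIcc 0 Real.pi Real.pi_nonneg x))
  s x := Matrix.toEuclideanCLM (𝕜 := ℂ) (L.primitive (projIcc 0 Real.pi Real.pi_nonneg x))
  h1 := Matrix.toEuclideanCLM (𝕜 := ℂ) L.h1
  h0 := Matrix.toEuclideanCLM (𝕜 := ℂ) L.h0
  H1 := Matrix.toEuclideanCLM (𝕜 := ℂ) L.H1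
  H0 := Matrix.toEuclideanCLM (𝕜 := ℂ) (L.H0 - L.primitive Real.pi)
  continuous_q := continuous_toEuclideanCLM.comp (continuous_pi fun j => continuous_pi fun k =>
    (L.absolutelyContinuous_Q1 j k).continuous_comp_projIcc _)
  continuous_s := continuous_toEuclideanCLM.comp (continuous_pi fun j => continuous_pi fun k =>
    (L.absolutelyContinuous_primitive j k).continuous_comp_projIcc _)

theorem toSystem_q (L : QuadraticPencil m) {x : ℝ} (hx : x ∈ Icc 0 Real.pi) :
    L.toSystem.q x = Matrix.toEuclideanCLM (𝕜 := ℂ) (L.Q1 x) := by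
  simp only [toSystem, projIcc_of_mem _ hx]

theorem toSystem_s (L : QuadraticPencil m) {x : ℝ} (hx : x ∈ Icc 0 Real.pi) :
    L.toSystem.s x = Matrix.toEuclideanCLM (𝕜 := ℂ) (L.primitive x) := by
  simp only [toSystem, projIcc_of_mem _ hx]

theorem NonRegge.toSystem (hL : L.NonRegge) : L.toSystem.Regular where
  add_h1 := by
    simpa [QuadraticPencil.toSystem] using isUnit_toEuclideanCLM hL.det_one_add_h1
  sub_h1 := by
    simpa [QuadraticPencil.toSystem] using isUnit_toEuclideanCLM hL.det_one_sub_h1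
  add_H1 := by
    simpa [QuadraticPencil.toSystem] using isUnit_toEuclideanCLM hL.det_one_add_H1
  sub_H1 := by
    simpa [QuadraticPencil.toSystem] using isUnit_toEuclideanCLM hL.det_one_sub_H1

theorem absolutelyContinuous_mul {A B : ℝ → Matrix (Fin m) (Fin m) ℂ} {a b : ℝ}
    (hA : ∀ j k, AbsolutelyContinuousOnInterval (fun x => A x j k) a b)
    (hB : ∀ j k, AbsolutelyContinuousOnInterval (fun x => B x j k) a b) (j k : Fin m) :
    AbsolutelyContinuousOnInterval (fun x => (A x * B x) j k) a b := by
  simp only [Matrix.mul_apply]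
  exact AbsolutelyContinuousOnInterval.finset_sum _ fun l => (hA j l).smul (hB l k)

theorem hasDerivAt_matrix_mul {A B : ℝ → Matrix (Fin m) (Fin m) ℂ}
    {A' B' : Matrix (Fin m) (Fin m) ℂ} {x : ℝ}
    (hA : ∀ j k, HasDerivAt (fun x => A x j k) (A' j k) x)
    (hB : ∀ j k, HasDerivAt (fun x => B x j k) (B' j k) x) (j k : Fin m) :
    HasDerivAt (fun x => (A x * B x) j k) ((A' * B x + A x * B') j k) x := by
  simp only [Matrix.mul_apply, Matrix.add_apply, ← Finset.sum_add_distrib]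
  exact HasDerivAt.fun_sum fun l _ => (hA j l).mul (hB l k)

/-- The second unknown `Y' + σ Y` of the first-order form. -/
noncomputable def quasiDerivative (L : QuadraticPencil m) (Y Y' : ℝ → Matrix (Fin m) (Fin m) ℂ)
    (x : ℝ) : Matrix (Fin m) (Fin m) ℂ :=
  Y' x + L.primitive x * Y x

theorem continuousOn_Icc_pi {f : ℝ → ℂ} (hf : AbsolutelyContinuousOnInterval f 0 Real.pi) :
    ContinuousOn f (Icc 0 Real.pi) := by
  simpa [uIcc_of_le Real.pi_nonneg] using hf.continuousOn

theorem continuousOn_matrix_mul {A B : ℝ → Matrix (Fin m) (Fin m) ℂ} {s : Set ℝ}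
    (hA : ∀ j k, ContinuousOn (fun x => A x j k) s)
    (hB : ∀ j k, ContinuousOn (fun x => B x j k) s) (j k : Fin m) :
    ContinuousOn (fun x => (A x * B x) j k) s := by
  simp only [Matrix.mul_apply]
  exact continuousOn_finsetSum _ fun l _ => (hA j l).mul (hB l k)

theorem IsSolution.absolutelyContinuous_fst {Y Y' : ℝ → Matrix (Fin m) (Fin m) ℂ}
    (h : L.IsSolution ρ Y Y') (j k : Fin m) :
    AbsolutelyContinuousOnInterval (fun x => Y x j k) 0 Real.pi := by
  refine absolutelyContinuousOnInterval_of_hasDerivWithinAt Real.pi_nonneg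
    (fun x hx => h.hasDeriv x hx j k) (continuousOn_Icc_pi (h.absolutelyContinuous j k))

theorem ae_restrict_Icc_mem_Ioo : ∀ᵐ x ∂(volume.restrict (Icc (0 : ℝ) Real.pi)),
    x ∈ Ioo 0 Real.pi := by
  rw [← restrict_Ioo_eq_restrict_Icc]
  exact ae_restrict_mem measurableSet_Ioo

theorem IsSolution.hasDerivWithinAt_quasiDerivative {Y Y' : ℝ → Matrix (Fin m) (Fin m) ℂ}
    (h : L.IsSolution ρ Y Y') {x : ℝ} (hx : x ∈ Icc 0 Real.pi) (j k : Fin m) :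
    HasDerivWithinAt (fun t => L.quasiDerivative Y Y' t j k)
      ((L.primitive x * Y' x - (ρ ^ 2 • Y x + (2 * Complex.I * ρ) • (L.Q1 x * Y x))) j k)
      (Icc 0 Real.pi) x := by
  have hac : ∀ j k, AbsolutelyContinuousOnInterval
      (fun t => L.quasiDerivative Y Y' t j k) 0 Real.pi := fun j k =>
    (h.absolutelyContinuous j k).add
      (absolutelyContinuous_mul L.absolutelyContinuous_primitive h.absolutelyContinuous_fst j k)
  refine (hac j k).hasDerivWithinAt_of_ae (f' := fun x => (L.primitive x * Y' x -
    (ρ ^ 2 • Y x + (2 * Complex.I * ρ) • (L.Q1 x * Y x))) j k) Real.pi_nonneg ?_ ?_ hx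
  · have h1 := continuousOn_Icc_pi (absolutelyContinuous_mul L.absolutelyContinuous_primitive
      h.absolutelyContinuous j k)
    have h2 := continuousOn_Icc_pi (absolutelyContinuous_mul L.absolutelyContinuous_Q1
      h.absolutelyContinuous_fst j k)
    have h3 := continuousOn_Icc_pi (h.absolutelyContinuous_fst j k)
    exact h1.sub ((h3.const_smul (ρ ^ 2)).add (h2.const_smul (2 * Complex.I * ρ)))
  · filter_upwards [h.equation, L.ae_hasDerivAt_primitive, ae_restrict_Icc_mem_Ioo] with x h1 h2 h3
    have hY : ∀ j k, HasDerivAt (fun t => Y t j k) (Y' x j k) x := fun j k =>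
      (h.hasDeriv x (Ioo_subset_Icc_self h3) j k).hasDerivAt (Icc_mem_nhds h3.1 h3.2)
    refine ((h1 j k).add (hasDerivAt_matrix_mul h2 hY j k)).congr_deriv ?_
    rw [← Matrix.neg_apply, ← Matrix.add_apply]
    refine congrFun (congrFun ?_ j) k
    simp only [potential, add_mul, smul_mul_assoc, one_mul]
    abel

theorem IsWeylSolution.isWeyl {Φ Φ' : ℝ → Matrix (Fin m) (Fin m) ℂ}
    (h : L.IsWeylSolution ρ Φ Φ') :
    L.toSystem.IsWeyl ρ Real.pi (Matrix.toEuclideanCLM (𝕜 := ℂ) (Φ 0)) := by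
  intro d
  have h0 : (0 : ℝ) ∈ Icc 0 Real.pi := left_mem_Icc.2 Real.pi_nonneg
  have hπ : Real.pi ∈ Icc 0 Real.pi := right_mem_Icc.2 Real.pi_nonneg
  obtain ⟨W, V, hW, hV, -, -⟩ := L.toSystem.exists_entire_fundamental Real.pi_nonneg
  set y : ℝ → EuclideanSpace ℂ (Fin m) × EuclideanSpace ℂ (Fin m) := fun x =>
    (Matrix.toEuclideanCLM (𝕜 := ℂ) (Φ x) d,
      Matrix.toEuclideanCLM (𝕜 := ℂ) (L.quasiDerivative Φ Φ' x) d) with hy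
  have hyd : ∀ x ∈ Icc 0 Real.pi,
      HasDerivWithinAt y (L.toSystem.gen ρ x (y x)) (Icc 0 Real.pi) x := fun x hx => by
    refine ((hasDerivWithinAt_toEuclideanCLM_apply (h.isSolution.hasDeriv x hx) d).prodMk
      (hasDerivWithinAt_toEuclideanCLM_apply
        (h.isSolution.hasDerivWithinAt_quasiDerivative hx) d)).congr_deriv ?_
    have hs := L.toSystem_s hx
    have hq := L.toSystem_q hx
    simp only [SystemPencil.gen, hs, hq, blockCLM_apply, hy, quasiDerivative, map_add, map_sub,
      map_smul, map_mul, add_apply, sub_apply, neg_apply, smul_apply, mul_apply_eq_comp,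
      one_apply_eq_self]
    refine Prod.ext ?_ ?_
    · simp
    · simp only
      abel
  have hprop : ∀ x ∈ Icc 0 Real.pi, W ρ x (y 0) = y x := fun x hx => by
    rw [← (hV ρ).apply_eq hyd hx, ← mul_apply_eq_comp, (hW ρ).mul_copropagator (hV ρ) hx,
      one_apply_eq_self]
  refine ⟨fun x => W ρ x (y 0), SystemPencil.isSol_apply (hW ρ) _, ?_, ?_, ?_⟩
  · beta_reduce
    rw [hprop 0 h0]
  · have := congrArg (fun A => Matrix.toEuclideanCLM (𝕜 := ℂ) A d) h.U_eq_one
    beta_reduce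
    rw [hprop 0 h0]
    simp only [hy, SystemPencil.leftForm, quasiDerivative, primitive_zero, zero_mul,
      add_zero]
    simpa [U, toSystem] using this
  · have := congrArg (fun A => Matrix.toEuclideanCLM (𝕜 := ℂ) A d) h.V_eq_zero
    beta_reduce
    rw [hprop _ hπ]
    simp only [hy, SystemPencil.rightForm, quasiDerivative, toSystem]
    simp only [QuadraticPencil.V, map_add, map_sub, map_smul, map_mul, add_apply, sub_apply,
      smul_apply, mul_apply_eq_comp, map_zero, zero_apply] at this ⊢
    rw [← this]
    abel

theorem mem_weylDomain_of_isWeyl {M : EuclideanSpace ℂ (Fin m) →L[ℂ] EuclideanSpace ℂ (Fin m)}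
    (h : L.toSystem.IsWeyl ρ Real.pi M) : ρ ∈ L.weylDomain := by
  choose w hw _ hl hr using fun k : Fin m => h (EuclideanSpace.single k 1)
  set Y : ℝ → Matrix (Fin m) (Fin m) ℂ := fun x => Matrix.of fun j k => (w k x).1 j with hY
  set Z : ℝ → Matrix (Fin m) (Fin m) ℂ := fun x => Matrix.of fun j k => (w k x).2 j with hZ
  have happ : ∀ (A : Matrix (Fin m) (Fin m) ℂ) (k : Fin m) x j,
      Matrix.toEuclideanCLM (𝕜 := ℂ) A (w k x).1 j = (A * Y x) j k := fun A k x j => by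
    rw [toEuclideanCLM_apply_apply, Matrix.mul_apply]; rfl
  have happ' : ∀ (A : Matrix (Fin m) (Fin m) ℂ) (k : Fin m) x j,
      Matrix.toEuclideanCLM (𝕜 := ℂ) A (w k x).2 j = (A * Z x) j k := fun A k x j => by
    rw [toEuclideanCLM_apply_apply, Matrix.mul_apply]; rfl
  have hYd : ∀ x ∈ Icc 0 Real.pi, ∀ j k,
      HasDerivAt (fun t => Y t j k) ((Z x - L.primitive x * Y x) j k) x := fun x hx j k => by
    refine (hasDerivAt_euclidean_apply (hasDerivAt_prod_fst (hw k x hx)) j).congr_deriv ?_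
    simp only [SystemPencil.gen, L.toSystem_s hx, blockCLM_apply, neg_apply, one_apply_eq_self,
      PiLp.add_apply, PiLp.neg_apply, happ, Matrix.sub_apply]
    simp only [hZ, Matrix.of_apply]
    ring
  have hZd : ∀ x ∈ Icc 0 Real.pi, ∀ j k, HasDerivAt (fun t => Z t j k)
      ((L.primitive x * Z x - (ρ ^ 2 • Y x + (2 * Complex.I * ρ) • (L.Q1 x * Y x)
        + L.primitive x * L.primitive x * Y x)) j k) x := fun x hx j k => by
    refine (hasDerivAt_euclidean_apply (hasDerivAt_prod_snd (hw k x hx)) j).congr_deriv ?_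
    simp only [SystemPencil.gen, L.toSystem_s hx, L.toSystem_q hx, blockCLM_apply, neg_apply,
      one_apply_eq_self, add_apply, smul_apply, ← map_mul, PiLp.add_apply, PiLp.neg_apply,
      PiLp.smul_apply, happ, happ', Matrix.sub_apply, Matrix.add_apply, Matrix.smul_apply]
    simp only [hY, Matrix.of_apply]
    ring
  have hYc : ∀ j k, ContinuousOn (fun x => Y x j k) (Icc 0 Real.pi) := fun j k x hx =>
    (hYd x hx j k).continuousAt.continuousWithinAt
  have hZc : ∀ j k, ContinuousOn (fun x => Z x j k) (Icc 0 Real.pi) := fun j k x hx =>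
    (hZd x hx j k).continuousAt.continuousWithinAt
  have hσc := fun j k => continuousOn_Icc_pi (L.absolutelyContinuous_primitive j k)
  have hQc := fun j k => continuousOn_Icc_pi (L.absolutelyContinuous_Q1 j k)
  have hYac : ∀ j k, AbsolutelyContinuousOnInterval (fun x => Y x j k) 0 Real.pi := fun j k =>
    absolutelyContinuousOnInterval_of_hasDerivWithinAt Real.pi_nonneg
      (fun x hx => (hYd x hx j k).hasDerivWithinAt)
      ((hZc j k).sub (continuousOn_matrix_mul hσc hYc j k))
  have hZac : ∀ j k, AbsolutelyContinuousOnInterval (fun x => Z x j k) 0 Real.pi := fun j k =>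
    absolutelyContinuousOnInterval_of_hasDerivWithinAt Real.pi_nonneg
      (fun x hx => (hZd x hx j k).hasDerivWithinAt)
      ((continuousOn_matrix_mul hσc hZc j k).sub ((((hYc j k).const_smul (ρ ^ 2)).add
        ((continuousOn_matrix_mul hQc hYc j k).const_smul (2 * Complex.I * ρ))).add
        (continuousOn_matrix_mul (continuousOn_matrix_mul hσc hσc) hYc j k)))
  refine ⟨Y, fun x => Z x - L.primitive x * Y x,
    ⟨fun x hx j k => (hYd x hx j k).hasDerivWithinAt, fun j k => ?_, ?_⟩, ?_, ?_⟩
  · exact (hZac j k).sub (absolutelyContinuous_mul L.absolutelyContinuous_primitive hYac j k)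
  · filter_upwards [L.ae_hasDerivAt_primitive, ae_restrict_mem measurableSet_Icc] with x h1 h2 j k
    refine ((hZd x h2 j k).sub (hasDerivAt_matrix_mul h1 (hYd x h2) j k)).congr_deriv ?_
    rw [← Matrix.neg_apply, ← Matrix.sub_apply]
    refine congrFun (congrFun ?_ j) k
    simp only [potential, add_mul, smul_mul_assoc, one_mul, mul_sub, mul_assoc]
    abel
  · ext j k
    have := congrArg (fun v => v.ofLp j) (hl k)
    simp only [SystemPencil.leftForm, toSystem, ← map_smul, ← map_add, PiLp.add_apply, happ] at this
    simp only [U, primitive_zero, zero_mul, sub_zero, Matrix.add_apply]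
    refine Eq.trans this ?_
    simp [Matrix.one_apply]
  · ext j k
    have := congrArg (fun v => v.ofLp j) (hr k)
    simp only [SystemPencil.rightForm, toSystem, ← map_smul, ← map_add, PiLp.add_apply, happ]
      at this
    simp only [QuadraticPencil.V, Matrix.add_apply]
    refine Eq.trans ?_ this
    simp only [add_mul, sub_mul, Matrix.add_apply, Matrix.sub_apply, hZ, Matrix.of_apply]
    ring

theorem weylMatrix_isWeyl (h : ρ ∈ L.weylDomain) :
    L.toSystem.IsWeyl ρ Real.pi (Matrix.toEuclideanCLM (𝕜 := ℂ) (L.weylMatrix ρ)) := by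
  have h' : ∃ Φ Φ' : ℝ → Matrix (Fin m) (Fin m) ℂ, L.IsWeylSolution ρ Φ Φ' := h
  obtain ⟨Φ', hΦ⟩ := h'.choose_spec
  rw [weylMatrix, dif_pos h']
  exact hΦ.isWeyl

end QuadraticPencil

theorem theorem1 (m : ℕ) (L L' : QuadraticPencil m) (hL : L.NonRegge) (hL' : L'.NonRegge)
    (hM : ∀ ρ ∈ L.weylDomain ∩ L'.weylDomain, L.weylMatrix ρ = L'.weylMatrix ρ) :
    Set.EqOn L.Q1 L'.Q1 (Set.Icc 0 Real.pi) ∧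
    (∀ᵐ x ∂(MeasureTheory.volume.restrict (Set.Icc 0 Real.pi)), L.Q0 x = L'.Q0 x) ∧
    L.h1 = L'.h1 ∧ L.h0 = L'.h0 ∧ L.H1 = L'.H1 ∧ L.H0 = L'.H0 := by
  have h0 : (0 : ℝ) ∈ Icc 0 Real.pi := left_mem_Icc.2 Real.pi_nonneg
  have hπ : Real.pi ∈ Icc 0 Real.pi := right_mem_Icc.2 Real.pi_nonneg
  have hop := EquivLike.injective (Matrix.toEuclideanCLM (𝕜 := ℂ) (n := Fin m))
  have hsame : SystemPencil.SameWeyl L.toSystem L'.toSystem Real.pi := by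
    rintro ρ ⟨M, hρ⟩ ⟨M', hρ'⟩
    have h1 := QuadraticPencil.mem_weylDomain_of_isWeyl hρ
    have h2 := QuadraticPencil.mem_weylDomain_of_isWeyl hρ'
    refine ⟨_, QuadraticPencil.weylMatrix_isWeyl h1, ?_⟩
    rw [hM ρ ⟨h1, h2⟩]
    exact QuadraticPencil.weylMatrix_isWeyl h2
  obtain ⟨hq, hs, hh1, hh0, hH1, hH0⟩ := hsame.eq hL.toSystem hL'.toSystem Real.pi_pos (by
    rw [L.toSystem_s h0, L'.toSystem_s h0, L.primitive_zero, L'.primitive_zero])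
  have hσ : EqOn L.primitive L'.primitive (Icc 0 Real.pi) := fun x hx => hop (by
    simpa only [L.toSystem_s hx, L'.toSystem_s hx] using hs hx)
  refine ⟨fun x hx => hop ?_, ?_, hop hh1, hop hh0, hop hH1, ?_⟩
  · simpa only [L.toSystem_q hx, L'.toSystem_q hx] using hq hx
  · filter_upwards [L.ae_hasDerivAt_primitive, L'.ae_hasDerivAt_primitive,
      QuadraticPencil.ae_restrict_Icc_mem_Ioo] with x h1 h2 h3
    ext j k
    refine (h1 j k).unique ((h2 j k).congr_of_eventuallyEq ?_)
    filter_upwards [Icc_mem_nhds h3.1 h3.2] with t ht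
    rw [hσ ht]
  · have : L.H0 - L.primitive Real.pi = L'.H0 - L'.primitive Real.pi := hop hH0
    rwa [hσ hπ, sub_left_inj] at this
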